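/- For complex $\alpha\notin N:=\{0,-1,-2,\dots\}$ let $\zeta(s,\alpha)$ be the Hurwitz zeta function, i.e. the analytic continuation in $s$ to $\mathbb C\setminus\{1\}$ of $\sum_{n\ge 0}(n+\alpha)^{-s}$ ($\operatorname{Re}s>1$, principal powers with $-\pi<\arg\le\pi$), and $\zeta^{(r)}(s,\alpha)=\frac{\partial^r}{\partial s^r}\zeta(s,\alpha)$ for integers $r\ge 0$. A *branch* of $\zeta(s,\alpha)$ at $\alpha_0\notin N$ is a function $Z(s,\alpha)$, analytic near all $(s,\alpha_0)$ with $s\ne 1$, obtained from $\zeta(s,\alpha)$ near $\alpha=1$ by analytic continuation in $\alpha$ (with $s\neq1$ as a parameter) along a path in $\mathbb C\setminus N$ from $1$ to $\alpha_0$. Let $\gamma_n(\alpha)$, $n\ge -1$, be defined by $s\,\zeta(s+1,\alpha)=\sum_{n\ge 0}\gamma_{n-1}(\alpha)s^n$ (the left side being $1$ at $s=0$), and likewise for each branch $Z$. Let $\psi=\Gamma'/\Gamma$. Then the following hold. **0)** For $\alpha\notin N$ the continuation exists and has a simple pole with residue $1$ at $s=1$; $\gamma_{-1}(\alpha)=1$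 and $\zeta(s+1,\alpha)=\frac1s+\sum_{n\ge 0}\gamma_n(\alpha)s^n$ for all $s\ne 0$. The function $\zeta(s,\alpha)$ is itself a branch at every $\alpha_0\in\mathbb C\setminus(-\infty,0]$; for $s\neq 1$, $r\ge 0$, $\zeta^{(r)}(s,\alpha)$ is analytic in $\alpha$ on $\mathbb C\setminus(-\infty,0]$; $\zeta(s,\alpha)$ can be continued analytically in $\alpha$ along every path in $\mathbb C\setminus N$ starting at $1$; and for every branch $Z$ at any $\alpha_0\notin N$ and $s\ne1$, $\alpha\mapsto Z^{(r)}(s,\alpha)$ is analytic at $\alpha_0$. So the only possible singularities in $\alpha$ are $0,-1,-2,\dots$. For every integer $k\ge 1$ there is $\phi_k(s,\alpha)$, analytic for $s\ne 1$, $|\alpha|<k$, such that for $s\neq1$, $r\ge0$, $|\alpha|<k$, $\alpha\notin N$, $$\zeta^{(r)}(s,\alpha)=\sum_{0\le n\le k-1}(n+\alpha)^{-s}(-\log(n+\alpha))^r+\phi_k^{(r)}(s,\alpha),\qquad \psi(\alpha)=-\sum_{0\le n\le k-1}\frac1{n+\alpha}+\frac{\partial}{\partial\alpha}\phi_k'(0,\alpha).$$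 **1)** For every integer $m\ge 0$, $\zeta(-m,\alpha)$ extends to an entire function of $\alpha$. **2)** For every integer $m\ge 2$, $\zeta(m,\alpha)$ is analytic in $\alpha$ on $\mathbb C\setminus N$ and has a pole of order exactly $m$ at each point of $N$. (For $m=1$, where $\zeta(s,\alpha)$ has its pole in $s$, the constant term $\gamma_0(\alpha)$ has a simple pole at each point of $N$.) **3)** Let $\operatorname{Re}s<0$ and $r\ge 0$. On any convex open $U\subset\mathbb C\setminus N$ on which $Z$ is a branch at every point, $\alpha\mapsto Z^{(r)}(s,\alpha)$ extends to a continuous function on $\overline U$, including the points of $N$ that lie in $\overline U$. **4)** For every branch $Z$ at $\alpha_0\notin N$, with the derivatives taken at $\alpha=\alpha_0$ and $\gamma_n$ belonging to $Z$: $\frac{\partial^{r_1}}{\partial\alpha^{r_1}}\frac{\partial^{r_2}}{\partial s^{r_2}}Z(s,\alpha)=\frac{\partial^{r_2}}{\partial s^{r_2}}\frac{\partial^{r_1}}{\partial\alpha^{r_1}}Z(s,\alpha)$ for $s\ne 1$, $r_1,r_2\ge 0$; $\frac{\partial}{\partial\alpha}Z^{(r)}(0,\alpha)=\bigl(\frac{\partial}{\partial\alpha}Z(s,\alpha)\bigr)^{(r)}\big|_{s=0}=-r!\,\gamma_{r-1}(\alpha)$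 for $r\ge 0$; $\exp Z'(0,\alpha)=\Gamma(\alpha)/\sqrt{2\pi}$; $\gamma_{-1}=1$ and $Z(s+1,\alpha_0)=\frac1s+\sum_{n\ge0}\gamma_n(\alpha_0)s^n$ for $s\neq 0$; and $\psi(\alpha_0)=-\gamma_0(\alpha_0)$. For $\zeta(s,\alpha)$ itself, $\psi(\alpha)=-\gamma_0(\alpha)$ for all $\alpha\notin N$, and $\psi(1)=-\gamma$ with $\gamma$ Euler's constant. **5)** $\psi=-\gamma_0$ is analytic on $\mathbb C\setminus N$ with a simple pole at each point of $N$; for $r\ge 1$, $\frac{d^r}{d\alpha^r}\psi(\alpha)=(-1)^{r-1}r!\,\zeta(r+1,\alpha)$ on $\mathbb C\setminus N$, and this is analytic on $\mathbb C\setminus N$ with a pole of order exactly $r+1$ at each point of $N$. -/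

import Mathlib

open Filter Topology

/-- The set `{0, -1, -2, …}` of non-positive integers in `ℂ`. -/
def nonposIntegers : Set ℂ := {α | ∃ n : ℕ, α = -(n : ℂ)}

/-- `F` is the analytic continuation to `ℂ ∖ {1}` of `s ↦ ∑_{n ≥ 0} (n + α)^(-s)`, `Re s > 1`
(principal powers, i.e. `-π < arg ≤ π`). -/
def IsHurwitzContinuation (α : ℂ) (F : ℂ → ℂ) : Prop :=
  DifferentiableOn ℂ F {1}ᶜ ∧
    ∀ s : ℂ, 1 < s.re → HasSum (fun n : ℕ => ((n : ℂ) + α) ^ (-s)) (F s)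

open Classical in
/-- The Hurwitz zeta function `ζ(s, α)` of two complex variables, for `α ∉ {0, -1, -2, …}` and
`s ≠ 1`: the analytic continuation in `s` of `∑_{n ≥ 0} (n + α)^(-s)`. It is unique on
`ℂ ∖ {1}`; its value at `s = 1`, and its values for `α ∈ {0, -1, -2, …}`, have no meaning. -/
noncomputable def hurwitzZetaFn (s α : ℂ) : ℂ :=
  if h : ∃ F, IsHurwitzContinuation α F then h.choose s else 0

/-- `Z^{(r)}(s, α) = ∂^r/∂s^r Z(s, α)`. -/
noncomputable def sDeriv (Z : ℂ → ℂ → ℂ) (r : ℕ) (s α : ℂ) : ℂ :=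
  iteratedDeriv r (fun w => Z w α) s

/-- The family `F t` (`0 ≤ t ≤ 1`) continues `ζ(s, α)` analytically in `α` along the path `p`,
which starts at `1`: `F t` is analytic in `(s, α)` at `(s, p t)` for all `s ≠ 1`, it is `ζ(s, α)`
near `α = 1` when `t = 0`, and neighbouring `F t`, `F t'` have the same germs at the points
`(s, p t')`. -/
def IsContinuationAlong {α₀ : ℂ} (p : Path (1 : ℂ) α₀) (F : unitInterval → ℂ → ℂ → ℂ) : Prop :=
  (∀ t : unitInterval, ∀ s : ℂ, s ≠ 1 →
      AnalyticAt ℂ (fun z : ℂ × ℂ => F t z.1 z.2) (s, p t)) ∧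
  (∀ s : ℂ, s ≠ 1 → ∀ᶠ z : ℂ × ℂ in 𝓝 (s, (1 : ℂ)), F 0 z.1 z.2 = hurwitzZetaFn z.1 z.2) ∧
  (∀ t : unitInterval, ∀ᶠ t' in 𝓝 t, ∀ s : ℂ, s ≠ 1 →
      ∀ᶠ z : ℂ × ℂ in 𝓝 (s, p t'), F t' z.1 z.2 = F t z.1 z.2)

/-- `Z(s, α)` is, for `α` near `α₀`, a branch of the (in general multivalued) Hurwitz zeta
function: it arises by analytic continuation in `α` along some path in `ℂ ∖ {0, -1, -2, …}`
from `1` to `α₀`. -/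
def IsHurwitzBranchAt (Z : ℂ → ℂ → ℂ) (α₀ : ℂ) : Prop :=
  ∃ p : Path (1 : ℂ) α₀, (∀ t, p t ∉ nonposIntegers) ∧
    ∃ F : unitInterval → ℂ → ℂ → ℂ, IsContinuationAlong p F ∧
      ∀ s : ℂ, s ≠ 1 → ∀ᶠ z : ℂ × ℂ in 𝓝 (s, α₀), Z z.1 z.2 = F 1 z.1 z.2

/-- The coefficients `γ_n(α)`, `n ≥ -1`, in `s Z(s + 1, α) = ∑_{n ≥ 0} γ_{n-1}(α) s^n`, where the
left side is continued to `s = 0` by the value `1`, as Taylor coefficients at `s = 0`.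
For the Hurwitz zeta function, `Z(s + 1, α) = 1/s + ∑_{n ≥ 0} γ_n(α) s^n`. -/
noncomputable def laurentGamma (Z : ℂ → ℂ → ℂ) (n : ℤ) (α : ℂ) : ℂ :=
  if n < -1 then 0
  else iteratedDeriv (n + 1).toNat (fun s : ℂ => if s = 0 then 1 else s * Z (s + 1) α) 0 /
    ((n + 1).toNat.factorial : ℂ)

/-! Everything rests on joint analyticity in the right half-plane. Taylor expansion of `∑ (n +
α)^(-s)` in `α` about `k + 1` has as coefficients rising factorials of `s` times values `ζ(s + j +
1, k + 1)`. The pole of each such value is cancelled by a factor of the rising factorial, so all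
coefficients but the zeroth are entire in `s`. Cauchy estimates for `Re s ≥ 2`, moved to arbitrary
`s` by `taylorCoeff_add`, bound them geometrically. The expansion therefore continues `ζ` to all `s
≠ 1`, jointly analytically, on the discs `|α - (k + 1)| < k + 1`, which exhaust `Re α > 0`.

Elsewhere `ζ(s, α) = ∑_{n < K} (n + α)^(-s) + ζ(s, α + K)`, and the multivaluedness sits in the
logarithms of finitely many `n + α`. Lifting a path through the covering `exp` continues these
logarithms; since continuation along a path is unique, every branch has this form
(`IsHurwitzBranchAt.exists_hasLogForm`). The assertions on branches are then read off `logSum`.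

The relation `∂ζ/∂α = -s ζ(s + 1, α)` holds termwise for `Re s > 1` and extends in `s` by the
identity theorem; at `s = 0` the residue `1` enters. With commuting partial derivatives it gives the
formulas for `γ_n`. Lerch's formula for `exp ζ'(0, α)` follows from Bohr–Mollerup on the positive
reals, and its logarithmic derivative gives `ψ = -γ_0`.

At integer `s` the choice of logarithm is immaterial, so the poles and the entire functions are
visible in the finite sum. For `Re s < 0` the terms `(n + α)^(-s) log^r (n + α)` tend to `0` at `α =
-n` within a convex set, which gives the continuous extension. -/

/-! ### Joint analyticity of power series with a parameter, and the identity theorem for germs. -/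

theorem AnalyticAt.clm_apply_of_analyticAt {D E : Type*} [NormedAddCommGroup D] [NormedSpace ℂ D]
    [NormedAddCommGroup E] [NormedSpace ℂ E] {e : D → E →L[ℂ] ℂ} {g : D → E} {z : D}
    (he : AnalyticAt ℂ e z) (hg : AnalyticAt ℂ g z) : AnalyticAt ℂ (fun y => e y (g y)) z :=
  ((ContinuousLinearMap.id ℂ (E →L[ℂ] ℂ)).analyticAt_bilinear (e z, g z)).comp₂ he hg

/-- A power series in the second variable whose coefficients are holomorphic in the first one and
satisfy uniform geometric bounds is jointly analytic. -/
theorem analyticAt_tsum_coeff_mul_pow {c : ℕ → ℂ → ℂ} {s₀ : ℂ} {r C ρ : ℝ} (hr : 0 < r)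
    (hρ : 0 < ρ) (hc : ∀ j, DifferentiableOn ℂ (c j) (Metric.ball s₀ r))
    (hb : ∀ j, ∀ s ∈ Metric.ball s₀ r, ‖c j s‖ * ρ ^ j ≤ C) {β : ℂ} (hβ : ‖β‖ < ρ) :
    AnalyticAt ℂ (fun z : ℂ × ℂ => ∑' j, c j z.1 * z.2 ^ j) (s₀, β) := by
  have hC : 0 ≤ C := le_trans (by positivity) (hb 0 s₀ (Metric.mem_ball_self hr))
  set q : ℝ := r / 2 with hq
  have hq0 : 0 < q := by positivity
  have hsub : Metric.closedBall s₀ q ⊆ Metric.ball s₀ r :=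
    Metric.closedBall_subset_ball (by rw [hq]; linarith)
  have hcauchy : ∀ i j, ‖(ρ : ℂ) ^ j * (iteratedDeriv i (c j) s₀ / (i.factorial : ℂ))‖
      ≤ C / q ^ i := by
    intro i j
    have h1 := Complex.norm_iteratedDeriv_le_of_forall_mem_sphere_norm_le (n := i) (f := c j)
      (c := s₀) (R := q) (C := C / ρ ^ j) hq0
      (((hc j).mono (by
        rw [closure_ball _ hq0.ne']; exact hsub)).diffContOnCl)
      (fun z hz => by
        rw [le_div_iff₀ (by positivity)]
        exact hb j z (hsub (Metric.sphere_subset_closedBall hz)))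
    rw [norm_mul, norm_div, norm_pow, Complex.norm_real, Real.norm_of_nonneg hρ.le,
      Complex.norm_natCast]
    have hf : (0 : ℝ) < i.factorial := by positivity
    calc ρ ^ j * (‖iteratedDeriv i (c j) s₀‖ / i.factorial)
        ≤ ρ ^ j * ((i.factorial * (C / ρ ^ j) / q ^ i) / i.factorial) := by gcongr
      _ = C / q ^ i := by field_simp
  -- The double series is written as a pairing of two one-variable holomorphic functions: the
  -- bounded sequence `(ρ ^ j * c j s)_j`, holomorphic in `s` with values in `ℓ^∞`, and a functional
  -- on `ℓ^∞` depending holomorphically on `β`. Here `a i` is the `i`-th Taylor coefficient of the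
  -- sequence at `s₀`.
  let a : ℕ → BoundedContinuousFunction ℕ ℂ := fun i =>
    BoundedContinuousFunction.ofNormedAddCommGroupDiscrete
      (fun j => (ρ : ℂ) ^ j * (iteratedDeriv i (c j) s₀ / (i.factorial : ℂ))) (C / q ^ i)
      (hcauchy i)
  have ha : ∀ i, ‖a i‖ ≤ C / q ^ i := fun i =>
    (BoundedContinuousFunction.norm_le (by positivity)).2 (hcauchy i)
  let g : ℂ → BoundedContinuousFunction ℕ ℂ := fun s => ∑' i, (s - s₀) ^ i • a i
  have hbound : ∀ i, ∀ s ∈ Metric.ball s₀ (q / 2), ‖(s - s₀) ^ i • a i‖ ≤ C * (1 / 2) ^ i := by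
    intro i s hs
    rw [norm_smul, norm_pow]
    have h2 : ‖s - s₀‖ ≤ q / 2 := by
      rw [Metric.mem_ball, dist_eq_norm] at hs; exact hs.le
    calc ‖s - s₀‖ ^ i * ‖a i‖ ≤ (q / 2) ^ i * (C / q ^ i) := by
          gcongr; exact ha i
      _ = C * (1 / 2) ^ i := by rw [div_pow q, one_div, inv_pow]; field_simp
  have hsum : Summable fun i : ℕ => C * (1 / 2 : ℝ) ^ i :=
    (summable_geometric_of_lt_one (by norm_num) (by norm_num)).mul_left C
  have hg : DifferentiableOn ℂ g (Metric.ball s₀ (q / 2)) :=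
    Complex.differentiableOn_tsum_of_summable_norm hsum
      (fun i => by fun_prop) Metric.isOpen_ball hbound
  have hga : AnalyticAt ℂ g s₀ := hg.analyticAt (Metric.ball_mem_nhds _ (by positivity))
  have hgval : ∀ s ∈ Metric.ball s₀ (q / 2), ∀ j, g s j = (ρ : ℂ) ^ j * c j s := by
    intro s hs j
    have hS : HasSum (fun i => (s - s₀) ^ i • a i) (g s) :=
      (Summable.of_norm_bounded hsum fun i => hbound i s hs).hasSum
    have h1 := hS.mapL (BoundedContinuousFunction.evalCLM ℂ j)
    have h2 := (Complex.hasSum_taylorSeries_on_ball (hc j)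
      (Metric.ball_subset_ball (by rw [hq]; linarith) hs)).mul_left ((ρ : ℂ) ^ j)
    refine h1.unique ?_
    have h3 : (fun i => BoundedContinuousFunction.evalCLM ℂ j ((s - s₀) ^ i • a i)) = fun i =>
        (ρ : ℂ) ^ j * ((i.factorial : ℂ)⁻¹ • (s - s₀) ^ i • iteratedDeriv i (c j) s₀) := by
      ext i
      have h4 : a i j = (ρ : ℂ) ^ j * (iteratedDeriv i (c j) s₀ / (i.factorial : ℂ)) := rfl
      simp only [BoundedContinuousFunction.evalCLM_apply, BoundedContinuousFunction.coe_smul, h4,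
        smul_eq_mul]
      ring
    rw [h3]
    exact h2
  obtain ⟨ρ', h1, h2⟩ := exists_between hβ
  have hρ' : 0 ≤ ρ' := (norm_nonneg _).trans h1.le
  -- The weights `(b / ρ) ^ j` undo the factor `ρ ^ j` and are summable in operator norm for `|b| <
  -- ρ' < ρ`.
  let e : ℂ → (BoundedContinuousFunction ℕ ℂ →L[ℂ] ℂ) := fun b =>
    ∑' j, (b / ρ) ^ j • BoundedContinuousFunction.evalCLM ℂ j
  have hebound : ∀ j, ∀ b ∈ Metric.ball (0 : ℂ) ρ',
      ‖(b / ρ) ^ j • (BoundedContinuousFunction.evalCLM ℂ j :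
        BoundedContinuousFunction ℕ ℂ →L[ℂ] ℂ)‖ ≤ (ρ' / ρ) ^ j := by
    intro j b hb'
    rw [norm_smul, norm_pow, norm_div, Complex.norm_real, Real.norm_of_nonneg hρ.le]
    have h3 : ‖b‖ ≤ ρ' := by simpa using (Metric.mem_ball.1 hb').le
    have h4 : ‖(BoundedContinuousFunction.evalCLM ℂ j :
        BoundedContinuousFunction ℕ ℂ →L[ℂ] ℂ)‖ ≤ 1 :=
      ContinuousLinearMap.opNorm_le_bound _ zero_le_one fun x => by
        simpa using x.norm_coe_le_norm j
    calc _ ≤ (ρ' / ρ) ^ j * 1 := by gcongr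
      _ = _ := mul_one _
  have hesum : Summable fun j : ℕ => (ρ' / ρ) ^ j :=
    summable_geometric_of_lt_one (by positivity) ((div_lt_one hρ).2 h2)
  have he : DifferentiableOn ℂ e (Metric.ball 0 ρ') :=
    Complex.differentiableOn_tsum_of_summable_norm
      (F := fun j (b : ℂ) => (b / ρ) ^ j • (BoundedContinuousFunction.evalCLM ℂ j :
        BoundedContinuousFunction ℕ ℂ →L[ℂ] ℂ)) hesum
      (fun i => by fun_prop) Metric.isOpen_ball hebound
  have hea : AnalyticAt ℂ e β :=
    he.analyticAt (Metric.isOpen_ball.mem_nhds (by simpa using h1))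
  have hmain : AnalyticAt ℂ (fun z : ℂ × ℂ => e z.2 (g z.1)) (s₀, β) :=
    AnalyticAt.clm_apply_of_analyticAt (e := fun z : ℂ × ℂ => e z.2) (g := fun z : ℂ × ℂ => g z.1)
      (AnalyticAt.comp_of_eq (g := e) hea analyticAt_snd rfl)
      (AnalyticAt.comp_of_eq (g := g) hga analyticAt_fst rfl)
  refine hmain.congr ?_
  have hm1 : ∀ᶠ z : ℂ × ℂ in 𝓝 (s₀, β), z.1 ∈ Metric.ball s₀ (q / 2) :=
    continuousAt_fst.eventually_mem (Metric.ball_mem_nhds _ (by positivity))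
  have hm2 : ∀ᶠ z : ℂ × ℂ in 𝓝 (s₀, β), z.2 ∈ Metric.ball (0 : ℂ) ρ' :=
    continuousAt_snd.eventually_mem (Metric.isOpen_ball.mem_nhds (by simpa using h1))
  filter_upwards [hm1, hm2] with z hz1 hz2
  have hS : HasSum (fun j => (z.2 / ρ) ^ j • (BoundedContinuousFunction.evalCLM ℂ j :
        BoundedContinuousFunction ℕ ℂ →L[ℂ] ℂ)) (e z.2) :=
    (Summable.of_norm_bounded hesum fun j => hebound j z.2 hz2).hasSum
  have h3 := hS.mapL (ContinuousLinearMap.apply ℂ ℂ (g z.1))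
  refine h3.tsum_eq.symm.trans (tsum_congr fun j => ?_)
  have hρj : (ρ : ℂ) ^ j ≠ 0 := pow_ne_zero _ (by exact_mod_cast hρ.ne')
  simp [hgval z.1 hz1 j, div_pow]
  field_simp

/-- On a ball where both functions are analytic, the identity theorem carries equality of germs from
any point back to the centre. This makes the set of points with equal germs relatively closed. -/
theorem AnalyticAt.eventually_eventuallyEq_imp {E : Type*} [NormedAddCommGroup E]
    [NormedSpace ℂ E] {f g : E → ℂ} {x : E} (hf : AnalyticAt ℂ f x) (hg : AnalyticAt ℂ g x) :
    ∀ᶠ y in 𝓝 x, f =ᶠ[𝓝 y] g → f =ᶠ[𝓝 x] g := by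
  obtain ⟨r, hr, h⟩ := Metric.eventually_nhds_iff_ball.1
    (hf.eventually_analyticAt.and hg.eventually_analyticAt)
  filter_upwards [Metric.ball_mem_nhds x hr] with y hy hyeq
  have h1 := AnalyticOnNhd.eqOn_of_preconnected_of_eventuallyEq (fun z hz => (h z hz).1)
    (fun z hz => (h z hz).2) (convex_ball x r).isPreconnected hy hyeq
  exact h1.eventuallyEq_of_mem (Metric.ball_mem_nhds x hr)

/-- The identity theorem, with equality of germs in the conclusion. -/
theorem AnalyticOnNhd.eventuallyEq_of_preconnected {E : Type*} [NormedAddCommGroup E]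
    [NormedSpace ℂ E] {f g : E → ℂ} {U : Set E} (hf : AnalyticOnNhd ℂ f U)
    (hg : AnalyticOnNhd ℂ g U) (hU : IsPreconnected U) {x : E} (hx : x ∈ U)
    (h : f =ᶠ[𝓝 x] g) {y : E} (hy : y ∈ U) : f =ᶠ[𝓝 y] g := by
  have key : U ⊆ {x | f =ᶠ[𝓝 x] g} := by
    refine hU.subset_of_closure_inter_subset isOpen_setOfPred_eventually_nhds ⟨x, hx, h⟩ ?_
    rintro z ⟨hz, hzU⟩
    obtain ⟨w, hw1, hw2⟩ := ((mem_closure_iff_frequently.1 hz).and_eventually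
      ((hf z hzU).eventually_eventuallyEq_imp (hg z hzU))).exists
    exact hw2 hw1
  exact key hy

/-! ### Iterated partial derivatives of jointly analytic functions. -/

section PartialDerivatives

variable {f : ℂ × ℂ → ℂ} {s a : ℂ}

theorem AnalyticAt.fderiv_apply {f : ℂ × ℂ → ℂ} {z : ℂ × ℂ} (hf : AnalyticAt ℂ f z)
    (v : ℂ × ℂ) : AnalyticAt ℂ (fun y => fderiv ℂ f y v) z :=
  hf.fderiv.clm_apply_of_analyticAt analyticAt_const

theorem AnalyticAt.hasDerivAt_fst (hf : AnalyticAt ℂ f (s, a)) :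
    HasDerivAt (fun w => f (w, a)) (fderiv ℂ f (s, a) (1, 0)) s :=
  hf.differentiableAt.hasFDerivAt.comp_hasDerivAt s
    ((hasDerivAt_id s).prodMk (hasDerivAt_const s a))

theorem AnalyticAt.hasDerivAt_snd (hf : AnalyticAt ℂ f (s, a)) :
    HasDerivAt (fun b => f (s, b)) (fderiv ℂ f (s, a) (0, 1)) a :=
  hf.differentiableAt.hasFDerivAt.comp_hasDerivAt a
    ((hasDerivAt_const a s).prodMk (hasDerivAt_id a))

/-- The `r`-th partial derivative with respect to the first variable. -/
noncomputable def iterPartialFst (f : ℂ × ℂ → ℂ) : ℕ → ℂ × ℂ → ℂ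
  | 0 => f
  | r + 1 => fun z => fderiv ℂ (iterPartialFst f r) z (1, 0)

/-- The `r`-th partial derivative with respect to the second variable. -/
noncomputable def iterPartialSnd (f : ℂ × ℂ → ℂ) : ℕ → ℂ × ℂ → ℂ
  | 0 => f
  | r + 1 => fun z => fderiv ℂ (iterPartialSnd f r) z (0, 1)

theorem AnalyticAt.iterPartialFst {z : ℂ × ℂ} (hf : AnalyticAt ℂ f z) (r : ℕ) :
    AnalyticAt ℂ (iterPartialFst f r) z := by
  induction r with
  | zero => exact hf
  | succ r ih => exact ih.fderiv_apply _

theorem AnalyticAt.iterPartialSnd {z : ℂ × ℂ} (hf : AnalyticAt ℂ f z) (r : ℕ) :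
    AnalyticAt ℂ (iterPartialSnd f r) z := by
  induction r with
  | zero => exact hf
  | succ r ih => exact ih.fderiv_apply _

/-- Stated on a neighbourhood, since the induction step differentiates the equality. -/
theorem iteratedDeriv_fst_eventuallyEq (hf : AnalyticAt ℂ f (s, a)) (r : ℕ) :
    ∀ᶠ z in 𝓝 (s, a), iteratedDeriv r (fun w => f (w, z.2)) z.1 = iterPartialFst f r z := by
  induction r with
  | zero => exact Eventually.of_forall fun z => by simp [iterPartialFst]
  | succ r ih =>
    filter_upwards [ih.eventually_nhds, hf.eventually_analyticAt] with z hz hfz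
    rw [iteratedDeriv_succ]
    have h1 : (fun w => iteratedDeriv r (fun w => f (w, z.2)) w)
        =ᶠ[𝓝 z.1] fun w => iterPartialFst f r (w, z.2) := by
      have hc : ContinuousAt (fun w : ℂ => (w, z.2)) z.1 := by fun_prop
      exact hc.eventually hz
    rw [h1.deriv_eq]
    exact ((hfz.iterPartialFst r).hasDerivAt_fst).deriv

theorem iteratedDeriv_snd_eventuallyEq (hf : AnalyticAt ℂ f (s, a)) (r : ℕ) :
    ∀ᶠ z in 𝓝 (s, a), iteratedDeriv r (fun b => f (z.1, b)) z.2 = iterPartialSnd f r z := by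
  induction r with
  | zero => exact Eventually.of_forall fun z => by simp [iterPartialSnd]
  | succ r ih =>
    filter_upwards [ih.eventually_nhds, hf.eventually_analyticAt] with z hz hfz
    rw [iteratedDeriv_succ]
    have h1 : (fun b => iteratedDeriv r (fun b => f (z.1, b)) b)
        =ᶠ[𝓝 z.2] fun b => iterPartialSnd f r (z.1, b) := by
      have hc : ContinuousAt (fun b : ℂ => (z.1, b)) z.2 := by fun_prop
      exact hc.eventually hz
    rw [h1.deriv_eq]
    exact ((hfz.iterPartialSnd r).hasDerivAt_snd).deriv

theorem fderiv_fderiv_apply_comm {z : ℂ × ℂ} (hf : AnalyticAt ℂ f z) (v w : ℂ × ℂ) :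
    fderiv ℂ (fun y => fderiv ℂ f y v) z w = fderiv ℂ (fun y => fderiv ℂ f y w) z v := by
  have hd : DifferentiableAt ℂ (fderiv ℂ f) z := hf.fderiv.differentiableAt
  have hsymm : IsSymmSndFDerivAt ℂ f z :=
    (hf.contDiffAt (n := minSmoothness ℂ 2)).isSymmSndFDerivAt le_rfl
  rw [fderiv_clm_apply hd (differentiableAt_const v), fderiv_clm_apply hd (differentiableAt_const w)]
  simpa using (hsymm v w).symm

/-- Symmetry of the second derivative moves a single derivative in the second variable past `r`
derivatives in the first, one at a time. -/
theorem iterPartialFst_fderiv_snd {z : ℂ × ℂ} (hf : AnalyticAt ℂ f z) (r : ℕ) :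
    ∀ᶠ y in 𝓝 z, fderiv ℂ (iterPartialFst f r) y (0, 1) =
      iterPartialFst (fun y => fderiv ℂ f y (0, 1)) r y := by
  induction r with
  | zero => exact Eventually.of_forall fun y => rfl
  | succ r ih =>
    filter_upwards [ih.eventually_nhds, hf.eventually_analyticAt] with y hy hfy
    change fderiv ℂ (fun x => fderiv ℂ (iterPartialFst f r) x (1, 0)) y (0, 1) =
      fderiv ℂ (iterPartialFst (fun y => fderiv ℂ f y (0, 1)) r) y (1, 0)
    rw [fderiv_fderiv_apply_comm (hfy.iterPartialFst r)]
    have h1 : (fun x => fderiv ℂ (iterPartialFst f r) x (0, 1)) =ᶠ[𝓝 y]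
      iterPartialFst (fun y => fderiv ℂ f y (0, 1)) r := hy
    rw [h1.fderiv_eq]

theorem iterPartialFst_iterPartialSnd {z : ℂ × ℂ} (hf : AnalyticAt ℂ f z) (r₁ r₂ : ℕ) :
    iterPartialSnd (iterPartialFst f r₁) r₂ =ᶠ[𝓝 z] iterPartialFst (iterPartialSnd f r₂) r₁ := by
  induction r₂ with
  | zero => exact Eventually.of_forall fun y => rfl
  | succ r₂ ih =>
    filter_upwards [ih.eventually_nhds, iterPartialFst_fderiv_snd (hf.iterPartialSnd r₂) r₁]
      with y hy h2
    change fderiv ℂ (iterPartialSnd (iterPartialFst f r₁) r₂) y (0, 1) =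
      iterPartialFst (fun y => fderiv ℂ (iterPartialSnd f r₂) y (0, 1)) r₁ y
    have h1 : iterPartialSnd (iterPartialFst f r₁) r₂ =ᶠ[𝓝 y]
      iterPartialFst (iterPartialSnd f r₂) r₁ := hy
    rw [h1.fderiv_eq, h2]

theorem analyticAt_iteratedDeriv_fst (hf : AnalyticAt ℂ f (s, a)) (r : ℕ) :
    AnalyticAt ℂ (fun z : ℂ × ℂ => iteratedDeriv r (fun w => f (w, z.2)) z.1) (s, a) :=
  (hf.iterPartialFst r).congr ((iteratedDeriv_fst_eventuallyEq hf r).mono fun _ h => h.symm)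

/-- Mixed iterated partial derivatives of a jointly analytic function commute. -/
theorem iteratedDeriv_comm (hf : AnalyticAt ℂ f (s, a)) (r₁ r₂ : ℕ) :
    iteratedDeriv r₁ (fun b => iteratedDeriv r₂ (fun w => f (w, b)) s) a =
      iteratedDeriv r₂ (fun w => iteratedDeriv r₁ (fun b => f (w, b)) a) s := by
  have hc1 : ContinuousAt (fun b : ℂ => (s, b)) a := by fun_prop
  have hc2 : ContinuousAt (fun w : ℂ => (w, a)) s := by fun_prop
  have h1 : (fun b => iteratedDeriv r₂ (fun w => f (w, b)) s) =ᶠ[𝓝 a]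
      fun b => iterPartialFst f r₂ (s, b) := hc1.eventually (iteratedDeriv_fst_eventuallyEq hf r₂)
  have h2 : (fun w => iteratedDeriv r₁ (fun b => f (w, b)) a) =ᶠ[𝓝 s]
      fun w => iterPartialSnd f r₁ (w, a) := hc2.eventually (iteratedDeriv_snd_eventuallyEq hf r₁)
  rw [h1.iteratedDeriv_eq, h2.iteratedDeriv_eq,
    (iteratedDeriv_snd_eventuallyEq (hf.iterPartialFst r₂) r₁).self_of_nhds,
    (iteratedDeriv_fst_eventuallyEq (hf.iterPartialSnd r₁) r₂).self_of_nhds]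
  exact (iterPartialFst_iterPartialSnd hf r₂ r₁).self_of_nhds

end PartialDerivatives

/-! ### Removing a simple pole with residue `1` at `s = 1`. -/

section Residue

variable {f : ℂ → ℂ}

/-- The residue makes `1` the continuous value at `0`, so the singularity is removable. -/
theorem differentiable_mul_translate (hf : DifferentiableOn ℂ f {1}ᶜ)
    (hres : Tendsto (fun s => (s - 1) * f s) (𝓝[≠] 1) (𝓝 1)) :
    Differentiable ℂ (fun s : ℂ => if s = 0 then 1 else s * f (s + 1)) := by
  have hne : ∀ s : ℂ, s ≠ 0 →
      DifferentiableAt ℂ (fun s : ℂ => if s = 0 then 1 else s * f (s + 1)) s := by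
    intro s hs
    have h1 : DifferentiableAt ℂ f (s + 1) :=
      hf.differentiableAt (isOpen_compl_singleton.mem_nhds (by simpa using hs))
    have h2 : DifferentiableAt ℂ (fun s => s * f (s + 1)) s :=
      differentiableAt_id.mul (h1.comp s (by fun_prop))
    refine h2.congr_of_eventuallyEq ?_
    filter_upwards [isOpen_compl_singleton.mem_nhds hs] with w hw
    rw [if_neg (Set.mem_compl_singleton_iff.1 hw)]
  intro s
  rcases eq_or_ne s 0 with rfl | hs
  · refine (Complex.analyticAt_of_differentiable_on_punctured_nhds_of_continuousAt
      (eventually_nhdsWithin_of_forall fun s hs => hne s hs) ?_).differentiableAt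
    rw [continuousAt_iff_punctured_nhds, if_pos rfl]
    have h1 : Tendsto (fun s : ℂ => s + 1) (𝓝[≠] 0) (𝓝[≠] 1) := by
      refine tendsto_nhdsWithin_iff.2 ⟨?_, ?_⟩
      · have : Tendsto (fun s : ℂ => s + 1) (𝓝 0) (𝓝 (0 + 1)) := by
          exact (continuous_id.add continuous_const).tendsto 0
        rw [zero_add] at this
        exact this.mono_left nhdsWithin_le_nhds
      · exact eventually_nhdsWithin_of_forall fun s hs => by simpa using hs
    refine (hres.comp h1).congr' ?_
    filter_upwards [self_mem_nhdsWithin] with s hs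
    rw [if_neg (Set.mem_compl_singleton_iff.1 hs)]
    simp
  · exact hne s hs

theorem hasSum_laurent (hf : DifferentiableOn ℂ f {1}ᶜ)
    (hres : Tendsto (fun s => (s - 1) * f s) (𝓝[≠] 1) (𝓝 1)) {s : ℂ} (hs : s ≠ 0) :
    HasSum (fun n : ℕ => iteratedDeriv (n + 1)
      (fun s : ℂ => if s = 0 then 1 else s * f (s + 1)) 0 / ((n + 1).factorial : ℂ) * s ^ n)
      (f (s + 1) - 1 / s) := by
  have h1 := Complex.hasSum_taylorSeries_of_entire (differentiable_mul_translate hf hres) 0 s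
  -- The constant Taylor term `1` is split off; division by `s` turns it into `1 / s`.
  rw [← hasSum_nat_add_iff' 1] at h1
  have h2 := h1.mul_left s⁻¹
  simp only [if_neg hs, Finset.range_one, Finset.sum_singleton, iteratedDeriv_zero, if_pos,
    Nat.factorial_zero, pow_zero, smul_eq_mul, sub_zero, Nat.cast_one] at h2
  have h3 : s⁻¹ * (s * f (s + 1) - (1 : ℂ)⁻¹ * (1 * 1)) = f (s + 1) - 1 / s := by field_simp
  rw [h3] at h2
  refine h2.congr_fun fun n => ?_
  rw [pow_succ]
  field_simp

end Residue

/-! ### Uniqueness of the continuation in `s`. -/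

theorem IsHurwitzContinuation.eqOn {a : ℂ} {F G : ℂ → ℂ} (hF : IsHurwitzContinuation a F)
    (hG : IsHurwitzContinuation a G) : Set.EqOn F G {1}ᶜ := by
  have hpre : IsPreconnected ({1}ᶜ : Set ℂ) :=
    (isConnected_compl_singleton_of_one_lt_rank (by simp) 1).isPreconnected
  refine AnalyticOnNhd.eqOn_of_preconnected_of_eventuallyEq
    (hF.1.analyticOnNhd isOpen_compl_singleton) (hG.1.analyticOnNhd isOpen_compl_singleton)
    hpre (z₀ := 2) (by norm_num) ?_
  have : {s : ℂ | 1 < s.re} ∈ 𝓝 (2 : ℂ) :=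
    (isOpen_lt continuous_const Complex.continuous_re).mem_nhds (by simp)
  filter_upwards [this] with s hs
  exact (hF.2 s hs).unique (hG.2 s hs)

theorem IsHurwitzContinuation.eq_hurwitzZetaFn {a s : ℂ} {F : ℂ → ℂ}
    (hF : IsHurwitzContinuation a F) (hs : s ≠ 1) : hurwitzZetaFn s a = F s := by
  have h : ∃ F, IsHurwitzContinuation a F := ⟨F, hF⟩
  rw [hurwitzZetaFn, dif_pos h]
  exact h.choose_spec.eqOn hF hs

theorem IsHurwitzContinuation.isHurwitzContinuation_hurwitzZetaFn {a : ℂ} {F : ℂ → ℂ}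
    (hF : IsHurwitzContinuation a F) : IsHurwitzContinuation a (fun s => hurwitzZetaFn s a) := by
  have h : ∃ F, IsHurwitzContinuation a F := ⟨F, hF⟩
  have h2 : (fun s => hurwitzZetaFn s a) = h.choose := by
    funext s
    rw [hurwitzZetaFn, dif_pos h]
  rw [h2]
  exact h.choose_spec

/-! ### The Hurwitz series for `Re s > 1`, `Re α > 0`. -/

section Series

/-- The argument of `n + a` is at most `π` in modulus, and `|n + a| ≥ n + δ`. The bound is uniform
over `Re a ≥ δ`. -/
theorem norm_natCast_add_cpow_neg_le {n : ℕ} {a s : ℂ} {δ : ℝ} (hδ : 0 < δ) (ha : δ ≤ a.re)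
    (hs : 0 ≤ s.re) :
    ‖((n : ℂ) + a) ^ (-s)‖ ≤ Real.exp (Real.pi * |s.im|) * ((n : ℝ) + δ) ^ (-s.re) := by
  have h1 := Complex.norm_cpow_le ((n : ℂ) + a) (-s)
  rw [div_eq_mul_inv, ← Real.exp_neg] at h1
  have hpos : (0 : ℝ) < n + δ := by positivity
  have h2 : (n : ℝ) + δ ≤ ‖(n : ℂ) + a‖ := by
    refine le_trans ?_ (Complex.re_le_norm _)
    simpa using ha
  have h3 : ‖(n : ℂ) + a‖ ^ (-s).re ≤ ((n : ℝ) + δ) ^ (-s.re) := by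
    rw [Complex.neg_re]
    exact Real.rpow_le_rpow_of_nonpos hpos h2 (by linarith)
  have h4 : -(Complex.arg ((n : ℂ) + a) * (-s).im) ≤ Real.pi * |s.im| := by
    calc _ ≤ |-(Complex.arg ((n : ℂ) + a) * (-s).im)| := le_abs_self _
      _ = |Complex.arg ((n : ℂ) + a)| * |s.im| := by simp [abs_mul]
      _ ≤ _ := by gcongr; exact Complex.abs_arg_le_pi _
  calc _ ≤ _ := h1
    _ ≤ ((n : ℝ) + δ) ^ (-s.re) * Real.exp (Real.pi * |s.im|) := by gcongr
    _ = _ := mul_comm _ _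

theorem summable_natCast_add_rpow_neg {δ x : ℝ} (hδ : 0 < δ) (hx : 1 < x) :
    Summable fun n : ℕ => ((n : ℝ) + δ) ^ (-x) := by
  refine ((Real.summable_one_div_nat_add_rpow δ x).2 hx).congr fun n => ?_
  have : (0 : ℝ) < n + δ := by positivity
  rw [abs_of_pos this, Real.rpow_neg this.le, one_div]

theorem summable_natCast_add_cpow_neg {s a : ℂ} (hs : 1 < s.re) (ha : 0 < a.re) :
    Summable fun n : ℕ => ((n : ℂ) + a) ^ (-s) :=
  Summable.of_norm_bounded ((summable_natCast_add_rpow_neg ha hs).mul_left _)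
    fun _ => norm_natCast_add_cpow_neg_le ha le_rfl (by linarith)

/-- The Hurwitz zeta series. -/
noncomputable def hurwitzSeries (s a : ℂ) : ℂ := ∑' n : ℕ, ((n : ℂ) + a) ^ (-s)

theorem natCast_add_mem_slitPlane {a : ℂ} (ha : 0 < a.re) (n : ℕ) :
    (n : ℂ) + a ∈ Complex.slitPlane :=
  Or.inl (by simp only [Complex.add_re, Complex.natCast_re]; positivity)

theorem hasDerivAt_natCast_add_cpow_neg {s a : ℂ} {n : ℕ} (ha : (n : ℂ) + a ∈ Complex.slitPlane) :
    HasDerivAt (fun a : ℂ => ((n : ℂ) + a) ^ (-s)) (-s * ((n : ℂ) + a) ^ (-(s + 1))) a := by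
  have h := ((hasDerivAt_id a).const_add (n : ℂ)).cpow_const (c := -s) ha
  rw [mul_one] at h
  have h2 : -(s + 1) = -s - 1 := by ring
  rw [h2]
  exact h

/-- Uniform convergence on the half-plane `Re b > Re a / 2` permits termwise differentiation. -/
theorem hasDerivAt_hurwitzSeries {s a : ℂ} (hs : 1 < s.re) (ha : 0 < a.re) :
    HasDerivAt (hurwitzSeries s) (-s * hurwitzSeries (s + 1) a) a := by
  set δ := a.re / 2 with hδdef
  have hδ : 0 < δ := by positivity
  set U : Set ℂ := {b | δ < b.re} with hU
  have hUo : IsOpen U := isOpen_lt continuous_const Complex.continuous_re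
  have haU : a ∈ U := by simp only [hU, Set.mem_ofPred_eq]; rw [hδdef]; linarith
  have hd : ∀ n : ℕ, ∀ b ∈ U,
      HasDerivAt (fun b : ℂ => ((n : ℂ) + b) ^ (-s)) (-s * ((n : ℂ) + b) ^ (-(s + 1))) b :=
    fun n b hb => hasDerivAt_natCast_add_cpow_neg (natCast_add_mem_slitPlane (hδ.trans hb) n)
  have hsum := (summable_natCast_add_rpow_neg hδ hs).mul_left (Real.exp (Real.pi * |s.im|))
  have hbd : ∀ n : ℕ, ∀ b ∈ U, ‖((n : ℂ) + b) ^ (-s)‖ ≤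
      Real.exp (Real.pi * |s.im|) * ((n : ℝ) + δ) ^ (-s.re) := fun n b hb =>
    norm_natCast_add_cpow_neg_le hδ (le_of_lt hb) (by linarith)
  have hdiff : ∀ n : ℕ, DifferentiableOn ℂ (fun b : ℂ => ((n : ℂ) + b) ^ (-s)) U :=
    fun n b hb => (hd n b hb).differentiableAt.differentiableWithinAt
  have h1 : DifferentiableOn ℂ (hurwitzSeries s) U :=
    Complex.differentiableOn_tsum_of_summable_norm hsum hdiff hUo hbd
  have h2 := Complex.hasSum_deriv_of_summable_norm hsum hdiff hUo hbd haU
  have h3 : HasSum (fun n : ℕ => deriv (fun b : ℂ => ((n : ℂ) + b) ^ (-s)) a)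
      (-s * hurwitzSeries (s + 1) a) := by
    have h4 := (summable_natCast_add_cpow_neg (s := s + 1) (a := a)
      (by simp; linarith) ha).hasSum.mul_left (-s)
    exact h4.congr_fun fun n => (hd n a haU).deriv
  have h5 := (h1.differentiableAt (hUo.mem_nhds haU)).hasDerivAt
  have h6 : deriv (hurwitzSeries s) a = -s * hurwitzSeries (s + 1) a := h2.unique h3
  rwa [h6] at h5

theorem iteratedDeriv_hurwitzSeries (j : ℕ) {s a : ℂ} (hs : 1 < s.re) (ha : 0 < a.re) :
    iteratedDeriv j (hurwitzSeries s) a =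
      (-1) ^ j * (∏ i ∈ Finset.range j, (s + i)) * hurwitzSeries (s + j) a := by
  induction j generalizing a with
  | zero => simp
  | succ j ih =>
    rw [iteratedDeriv_succ]
    have h1 : iteratedDeriv j (hurwitzSeries s) =ᶠ[𝓝 a] fun b =>
        (-1) ^ j * (∏ i ∈ Finset.range j, (s + i)) * hurwitzSeries (s + j) b := by
      filter_upwards [(isOpen_lt continuous_const Complex.continuous_re).mem_nhds ha] with b hb
      exact ih hb
    rw [h1.deriv_eq]
    have h2 : 1 < (s + j).re := by
      simp only [Complex.add_re, Complex.natCast_re]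
      have : (0 : ℝ) ≤ j := by positivity
      linarith
    rw [((hasDerivAt_hurwitzSeries h2 ha).const_mul _).deriv, Finset.prod_range_succ]
    push_cast
    rw [← add_assoc]
    ring

end Series

/-! ### Continuation in `s` through Taylor expansion in `α` about `k + 1`. -/

section Continuation

/-- `∑_{n ≥ k} (n + 1)^(-s)`, continued analytically. -/
noncomputable def zetaTail (k : ℕ) (s : ℂ) : ℂ :=
  riemannZeta s - ∑ n ∈ Finset.range k, ((n : ℂ) + 1) ^ (-s)

theorem hurwitzSeries_natCast_add_one (k : ℕ) {s : ℂ} (hs : 1 < s.re) :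
    hurwitzSeries s ((k : ℂ) + 1) = zetaTail k s := by
  have h1 : Summable fun n : ℕ => ((n : ℂ) + 1) ^ (-s) :=
    summable_natCast_add_cpow_neg hs (by simp)
  have h2 : riemannZeta s = ∑' n : ℕ, ((n : ℂ) + 1) ^ (-s) := by
    rw [zeta_eq_tsum_one_div_nat_add_one_cpow hs]
    exact tsum_congr fun n => by rw [Complex.cpow_neg, one_div]
  rw [zetaTail, h2, ← h1.sum_add_tsum_nat_add k, add_sub_cancel_left, hurwitzSeries]
  refine tsum_congr fun n => ?_
  push_cast
  ring_nf

theorem differentiable_natCast_add_one_cpow_neg (n : ℕ) :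
    Differentiable ℂ fun s : ℂ => ((n : ℂ) + 1) ^ (-s) :=
  fun _ => DifferentiableAt.const_cpow (by fun_prop) (Or.inl (Nat.cast_add_one_ne_zero n))

theorem differentiableOn_zetaTail (k : ℕ) : DifferentiableOn ℂ (zetaTail k) {1}ᶜ := by
  refine DifferentiableOn.sub
    (fun s hs => (differentiableAt_riemannZeta hs).differentiableWithinAt) ?_
  exact DifferentiableOn.fun_sum fun n _ =>
    (differentiable_natCast_add_one_cpow_neg n).differentiableOn

theorem tendsto_sub_one_mul_of_continuousAt {f : ℂ → ℂ} (hf : ContinuousAt f 1) :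
    Tendsto (fun s => (s - 1) * f s) (𝓝[≠] 1) (𝓝 0) := by
  have h : Tendsto (fun s => (s - 1) * f s) (𝓝 1) (𝓝 ((1 - 1) * f 1)) :=
    ((continuous_id.sub continuous_const).tendsto 1).mul hf
  rw [sub_self, zero_mul] at h
  exact h.mono_left nhdsWithin_le_nhds

theorem tendsto_sub_one_mul_zetaTail (k : ℕ) :
    Tendsto (fun s => (s - 1) * zetaTail k s) (𝓝[≠] 1) (𝓝 1) := by
  have h1 : Differentiable ℂ fun s : ℂ => ∑ n ∈ Finset.range k, ((n : ℂ) + 1) ^ (-s) :=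
    Differentiable.fun_sum fun n _ => differentiable_natCast_add_one_cpow_neg n
  have h2 := riemannZeta_residue_one.sub
    (tendsto_sub_one_mul_of_continuousAt (h1 1).continuousAt)
  rw [sub_zero] at h2
  refine h2.congr fun s => ?_
  rw [zetaTail]
  ring

/-- `s ζ(s + 1, k + 1)` as an entire function. -/
noncomputable def regularizedTail (k : ℕ) (s : ℂ) : ℂ :=
  if s = 0 then 1 else s * zetaTail k (s + 1)

theorem differentiable_regularizedTail (k : ℕ) : Differentiable ℂ (regularizedTail k) :=
  differentiable_mul_translate (differentiableOn_zetaTail k) (tendsto_sub_one_mul_zetaTail k)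

/-- The coefficient of `β ^ (j + 1)` in the expansion of `ζ(s, k + 1 + β)`. -/
noncomputable def taylorCoeff (k j : ℕ) (s : ℂ) : ℂ :=
  (-1) ^ (j + 1) * (∏ i ∈ Finset.range j, (s + i)) * regularizedTail k (s + j) /
    ((j + 1).factorial : ℂ)

theorem differentiable_taylorCoeff (k j : ℕ) : Differentiable ℂ (taylorCoeff k j) := by
  have h1 : Differentiable ℂ fun s : ℂ => regularizedTail k (s + j) :=
    (differentiable_regularizedTail k).comp (by fun_prop)
  have h2 : Differentiable ℂ fun s : ℂ => ∏ i ∈ Finset.range j, (s + i) :=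
    Differentiable.fun_finsetProd fun i _ => by fun_prop
  exact ((h2.const_mul _).mul h1).div_const _

theorem add_natCast_ne_zero {s : ℂ} (hs : 0 < s.re) (j : ℕ) : s + j ≠ 0 := by
  intro h
  have h1 := congrArg Complex.re h
  simp only [Complex.add_re, Complex.natCast_re, Complex.zero_re] at h1
  have : (0 : ℝ) ≤ j := by positivity
  linarith

/-- The last factor `s + j` of the rising factorial is absorbed by `regularizedTail`, where it
cancels the pole at `s = -j`. This is why `taylorCoeff` is entire although the derivative is only
given for `Re s > 1`. -/
theorem taylorCoeff_eq_iteratedDeriv (k j : ℕ) {s : ℂ} (hs : 1 < s.re) :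
    taylorCoeff k j s = iteratedDeriv (j + 1) (hurwitzSeries s) ((k : ℂ) + 1) /
      ((j + 1).factorial : ℂ) := by
  have hre : 1 < (s + ((j + 1 : ℕ) : ℂ)).re := by
    simp only [Complex.add_re, Complex.natCast_re]
    have : (0 : ℝ) ≤ (j + 1 : ℕ) := by positivity
    linarith
  rw [iteratedDeriv_hurwitzSeries _ hs (by simp; positivity), hurwitzSeries_natCast_add_one k hre,
    taylorCoeff, regularizedTail, if_neg (add_natCast_ne_zero (by linarith) j),
    Finset.prod_range_succ]
  push_cast
  rw [← add_assoc]
  ring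

theorem differentiableOn_hurwitzSeries {s : ℂ} (hs : 1 < s.re) :
    DifferentiableOn ℂ (hurwitzSeries s) {a | 0 < a.re} :=
  fun _ ha => (hasDerivAt_hurwitzSeries hs ha).differentiableAt.differentiableWithinAt

theorem closedBall_natCast_add_one_subset {k : ℕ} {ρ : ℝ} {b : ℂ}
    (hb : b ∈ Metric.closedBall ((k : ℂ) + 1) ρ) : (k : ℝ) + 1 - ρ ≤ b.re := by
  rw [Metric.mem_closedBall, dist_comm, dist_eq_norm] at hb
  have h := (Complex.re_le_norm _).trans hb
  simp only [Complex.sub_re, Complex.add_re, Complex.natCast_re, Complex.one_re] at h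
  linarith

/-- The disc of radius `k + 1` about `k + 1` lies in the right half-plane. The zeroth term is kept
apart, being the only one with a pole in `s`. -/
theorem hasSum_taylorCoeff (k : ℕ) {s β : ℂ} (hs : 1 < s.re) (hβ : ‖β‖ < k + 1) :
    HasSum (fun j => taylorCoeff k j s * β ^ (j + 1))
      (hurwitzSeries s ((k : ℂ) + 1 + β) - zetaTail k s) := by
  have hd : DifferentiableOn ℂ (hurwitzSeries s) (Metric.ball ((k : ℂ) + 1) (k + 1)) := by
    intro b hb
    refine (hasDerivAt_hurwitzSeries hs ?_).differentiableAt.differentiableWithinAt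
    rw [Metric.mem_ball] at hb
    have := closedBall_natCast_add_one_subset (Metric.mem_closedBall.2 (le_refl (dist b (k + 1))))
    linarith
  have h1 := Complex.hasSum_taylorSeries_on_ball hd (z := (k : ℂ) + 1 + β)
    (by simpa [Metric.mem_ball, dist_eq_norm] using hβ)
  rw [← hasSum_nat_add_iff' 1] at h1
  simp only [Finset.range_one, Finset.sum_singleton, iteratedDeriv_zero,
    Nat.factorial_zero, pow_zero, smul_eq_mul, Nat.cast_one, inv_one, one_mul,
    hurwitzSeries_natCast_add_one k hs, add_sub_cancel_left] at h1
  refine h1.congr_fun fun j => ?_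
  rw [taylorCoeff_eq_iteratedDeriv k j hs]
  field_simp

/-- Cauchy's estimate on the circle of radius `ρ` about `k + 1`, on which the series is bounded
uniformly in `s`. -/
theorem taylorCoeff_bound_of_two_le (k : ℕ) {ρ X Y : ℝ} (hρ : 0 < ρ) (hρk : ρ < k + 1) :
    ∃ M : ℝ, 0 ≤ M ∧ ∀ s : ℂ, 2 ≤ s.re → s.re ≤ X → |s.im| ≤ Y → ∀ j,
      ‖taylorCoeff k j s‖ * ρ ^ (j + 1) ≤ M := by
  set δ : ℝ := min 1 (k + 1 - ρ) with hδdef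
  have hδ : 0 < δ := lt_min one_pos (by linarith)
  have hδ1 : δ ≤ 1 := min_le_left _ _
  set S : ℝ := ∑' n : ℕ, ((n : ℝ) + δ) ^ (-2 : ℝ) with hS
  have hsum : Summable fun n : ℕ => ((n : ℝ) + δ) ^ (-2 : ℝ) :=
    summable_natCast_add_rpow_neg hδ (by norm_num)
  have hS0 : 0 ≤ S := tsum_nonneg fun n => by positivity
  -- The exponent `-s.re` is split as `-(s.re - 2)` and `-2`: the first power is at most `δ ^ (-X)`
  -- because `δ ≤ 1`, the second is summed in `S`.
  set D : ℝ := Real.exp (Real.pi * Y) * δ ^ (-X) with hD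
  have hD0 : 0 < D := by positivity
  refine ⟨D * S, by positivity, fun s hs2 hsX hsY j => ?_⟩
  have hs1 : 1 < s.re := by linarith
  have hbound : ∀ b ∈ Metric.sphere ((k : ℂ) + 1) ρ, ‖hurwitzSeries s b‖ ≤ D * S := by
    intro b hb
    have hbre : δ ≤ b.re :=
      (min_le_right _ _).trans
        (closedBall_natCast_add_one_subset (Metric.sphere_subset_closedBall hb))
    refine tsum_of_norm_bounded (hsum.hasSum.mul_left D) fun n => ?_
    refine (norm_natCast_add_cpow_neg_le hδ hbre (by linarith)).trans ?_
    have hpos : (0 : ℝ) < n + δ := by positivity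
    have e1 : ((n : ℝ) + δ) ^ (-s.re) = ((n : ℝ) + δ) ^ (-(s.re - 2)) * ((n : ℝ) + δ) ^ (-2 : ℝ) := by
      rw [← Real.rpow_add hpos]; ring_nf
    have e2 : ((n : ℝ) + δ) ^ (-(s.re - 2)) ≤ δ ^ (-X) := by
      refine (Real.rpow_le_rpow_of_nonpos hδ (by simp) (by linarith)).trans ?_
      exact Real.rpow_le_rpow_of_exponent_ge hδ hδ1 (by linarith)
    have e3 : Real.exp (Real.pi * |s.im|) ≤ Real.exp (Real.pi * Y) := by gcongr
    rw [e1, hD, mul_assoc]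
    gcongr
  have hdc : DiffContOnCl ℂ (hurwitzSeries s) (Metric.ball ((k : ℂ) + 1) ρ) := by
    refine DifferentiableOn.diffContOnCl ?_
    rw [closure_ball _ hρ.ne']
    refine (differentiableOn_hurwitzSeries hs1).mono fun b hb => ?_
    have := closedBall_natCast_add_one_subset hb
    exact lt_of_lt_of_le (by linarith) this
  have h1 := Complex.norm_iteratedDeriv_le_of_forall_mem_sphere_norm_le (j + 1) hρ hdc hbound
  rw [taylorCoeff_eq_iteratedDeriv k j hs1, norm_div, Complex.norm_natCast]
  have hf : (0 : ℝ) < (j + 1).factorial := by positivity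
  calc _ ≤ ((j + 1).factorial * (D * S) / ρ ^ (j + 1)) / (j + 1).factorial * ρ ^ (j + 1) := by
        gcongr
    _ = D * S := by field_simp

/-- The rising factorial splits at `m`. Raising the index by `m` moves `s` to `s + m`, so bounds for
large real part reach every `s`. -/
theorem taylorCoeff_add (k m j : ℕ) (s : ℂ) :
    taylorCoeff k (m + j) s = (-1) ^ m * (∏ i ∈ Finset.range m, (s + i)) *
      (((j + 1).factorial : ℂ) / ((m + j + 1).factorial : ℂ)) * taylorCoeff k j (s + m) := by
  have h1 : ((j + 1).factorial : ℂ) ≠ 0 := by exact_mod_cast (j + 1).factorial_ne_zero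
  have h2 : ((m + j + 1).factorial : ℂ) ≠ 0 := by exact_mod_cast (m + j + 1).factorial_ne_zero
  rw [taylorCoeff, taylorCoeff, Finset.prod_range_add]
  push_cast
  simp only [← add_assoc]
  field_simp
  ring

/-- Locally uniform geometric bounds for the Taylor coefficients. -/
theorem exists_taylorCoeff_bound (k : ℕ) {ρ : ℝ} (hρ : 0 < ρ) (hρk : ρ < k + 1) (s₀ : ℂ) :
    ∃ C : ℝ, ∀ j, ∀ s ∈ Metric.ball s₀ 1, ‖taylorCoeff k j s‖ * ρ ^ j ≤ C := by
  -- This makes `Re (s + m) > 2` for all `s` in the unit ball about `s₀`.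
  obtain ⟨m, hm⟩ := exists_nat_gt (3 - s₀.re)
  obtain ⟨M, hM0, hM⟩ := taylorCoeff_bound_of_two_le k (X := s₀.re + 1 + m) (Y := |s₀.im| + 1) hρ hρk
  have hsmall : ∃ C : ℝ, ∀ j < m, ∀ s ∈ Metric.ball s₀ 1, ‖taylorCoeff k j s‖ * ρ ^ j ≤ C := by
    have h : ∀ j, ∃ C : ℝ, ∀ s ∈ Metric.ball s₀ 1, ‖taylorCoeff k j s‖ * ρ ^ j ≤ C := by
      intro j
      obtain ⟨C, hC⟩ := (isCompact_closedBall s₀ 1).exists_bound_of_continuousOn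
        (differentiable_taylorCoeff k j).continuous.continuousOn
      exact ⟨C * ρ ^ j, fun s hs => by
        gcongr; exact hC s (Metric.ball_subset_closedBall hs)⟩
    choose C hC using h
    refine ⟨∑ j ∈ Finset.range m, |C j|, fun j hj s hs => ?_⟩
    exact (hC j s hs).trans ((le_abs_self _).trans
      (Finset.single_le_sum (f := fun j => |C j|) (fun _ _ => abs_nonneg _)
        (Finset.mem_range.2 hj)))
  obtain ⟨C, hC⟩ := hsmall
  -- `C` serves the finitely many `j < m`. In the other bound the power of `‖s₀‖ + 1 + m` majorises
  -- the `m` factors `s + i`, and `ρ ^ m / ρ` converts the weight `ρ ^ (i + 1)` of `M` into `ρ ^ (m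
  -- + i)`.
  refine ⟨max C ((‖s₀‖ + 1 + m) ^ m * M * ρ ^ m / ρ), fun j s hs => ?_⟩
  rcases lt_or_ge j m with hj | hj
  · exact (hC j hj s hs).trans (le_max_left _ _)
  refine le_trans ?_ (le_max_right _ _)
  obtain ⟨i, rfl⟩ := Nat.exists_eq_add_of_le hj
  rw [Metric.mem_ball, dist_eq_norm] at hs
  have hre := (Complex.abs_re_le_norm (s - s₀)).trans hs.le
  have him := (Complex.abs_im_le_norm (s - s₀)).trans hs.le
  rw [Complex.sub_re, abs_le] at hre
  rw [Complex.sub_im] at him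
  have him2 : |s.im| ≤ |s₀.im| + 1 := by
    have := abs_sub_abs_le_abs_sub s.im s₀.im
    linarith
  have hsm : (s + m).re = s.re + m := by simp
  have hb := hM (s + m) (by rw [hsm]; linarith) (by rw [hsm]; linarith) (by simpa using him2) i
  rw [taylorCoeff_add k m i]
  simp only [norm_mul, norm_pow, norm_neg, norm_one, one_pow, one_mul, norm_div,
    Complex.norm_natCast]
  have hprod : ‖∏ i ∈ Finset.range m, (s + i)‖ ≤ (‖s₀‖ + 1 + m) ^ m := by
    rw [norm_prod]
    refine (Finset.prod_le_prod (g := fun _ => ‖s₀‖ + 1 + m) (fun _ _ => norm_nonneg _)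
      fun i hi => ?_).trans_eq (by simp)
    have h1 : ‖s‖ ≤ ‖s₀‖ + 1 := by
      have := norm_sub_norm_le s s₀
      linarith
    have h2 : (i : ℝ) ≤ m := by exact_mod_cast (Finset.mem_range.1 hi).le
    calc ‖s + i‖ ≤ ‖s‖ + ‖(i : ℂ)‖ := norm_add_le _ _
      _ ≤ _ := by rw [Complex.norm_natCast]; linarith
  have hfac : ((i + 1).factorial : ℝ) / ((m + i + 1).factorial : ℝ) ≤ 1 := by
    rw [div_le_one (by positivity)]
    exact_mod_cast Nat.factorial_le (by omega)
  calc ‖∏ i ∈ Finset.range m, (s + i)‖ * ((i + 1).factorial / (m + i + 1).factorial) *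
        ‖taylorCoeff k i (s + m)‖ * ρ ^ (m + i)
      ≤ (‖s₀‖ + 1 + m) ^ m * 1 * ‖taylorCoeff k i (s + m)‖ * ρ ^ (m + i) := by gcongr
    _ = (‖s₀‖ + 1 + m) ^ m * (‖taylorCoeff k i (s + m)‖ * ρ ^ (i + 1)) * ρ ^ m / ρ := by
        field_simp; ring
    _ ≤ _ := by gcongr

/-- The non-polar part `ζ(s, k + 1 + β) - ζ(s, k + 1)`, divided by `β`. -/
noncomputable def taylorQuotient (k : ℕ) (s β : ℂ) : ℂ := ∑' j, taylorCoeff k j s * β ^ j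

theorem analyticAt_taylorQuotient (k : ℕ) (s : ℂ) {β : ℂ} (hβ : ‖β‖ < k + 1) :
    AnalyticAt ℂ (fun z : ℂ × ℂ => taylorQuotient k z.1 z.2) (s, β) := by
  obtain ⟨ρ, h1, h2⟩ := exists_between hβ
  have hρ : 0 < ρ := (norm_nonneg _).trans_lt h1
  obtain ⟨C, hC⟩ := exists_taylorCoeff_bound k hρ h2 s
  exact analyticAt_tsum_coeff_mul_pow one_pos hρ
    (fun j => (differentiable_taylorCoeff k j).differentiableOn) hC h1

theorem hasSum_natCast_add_one_add (k : ℕ) {s β : ℂ} (hs : 1 < s.re) (hβ : ‖β‖ < k + 1) :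
    HasSum (fun n : ℕ => ((n : ℂ) + ((k : ℂ) + 1 + β)) ^ (-s))
      (zetaTail k s + β * taylorQuotient k s β) := by
  have h1 : zetaTail k s + β * taylorQuotient k s β = hurwitzSeries s ((k : ℂ) + 1 + β) := by
    rw [taylorQuotient, ← tsum_mul_left]
    have h2 := (hasSum_taylorCoeff k hs hβ).tsum_eq
    have h3 : ∀ j, β * (taylorCoeff k j s * β ^ j) = taylorCoeff k j s * β ^ (j + 1) := by
      intro j; ring
    simp only [h3, h2]
    ring
  rw [h1]
  refine (summable_natCast_add_cpow_neg hs ?_).hasSum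
  have := Complex.abs_re_le_norm β
  have h4 := (abs_le.1 this).1
  simp only [Complex.add_re, Complex.natCast_re, Complex.one_re]
  linarith

theorem isHurwitzContinuation_taylor (k : ℕ) {β : ℂ} (hβ : ‖β‖ < k + 1) :
    IsHurwitzContinuation ((k : ℂ) + 1 + β) fun s => zetaTail k s + β * taylorQuotient k s β := by
  refine ⟨(differentiableOn_zetaTail k).add ?_, fun s hs => hasSum_natCast_add_one_add k hs hβ⟩
  intro s _
  exact ((analyticAt_taylorQuotient k s hβ).hasDerivAt_fst.differentiableAt.const_mul
    β).differentiableWithinAt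

end Continuation

/-! ### Joint analyticity and the pole at `s = 1` for `Re α > 0`. -/

section RightHalfPlane

/-- After squaring, the claim is `|a|² < 2 (k + 1) Re a`, true for large `k`. -/
theorem exists_norm_sub_lt {a : ℂ} (ha : 0 < a.re) : ∃ k : ℕ, ‖a - ((k : ℂ) + 1)‖ < k + 1 := by
  obtain ⟨k, hk⟩ := exists_nat_gt (‖a‖ ^ 2 / (2 * a.re))
  refine ⟨k, ?_⟩
  rw [div_lt_iff₀ (by positivity)] at hk
  refine lt_of_pow_lt_pow_left₀ 2 (by positivity) ?_
  rw [← Complex.normSq_eq_norm_sq, Complex.normSq_apply] at hk ⊢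
  simp only [Complex.sub_re, Complex.add_re, Complex.natCast_re, Complex.one_re, Complex.sub_im,
    Complex.add_im, Complex.natCast_im, Complex.one_im]
  nlinarith

theorem hurwitzZetaFn_eq_taylor {k : ℕ} {a s : ℂ} (ha : ‖a - ((k : ℂ) + 1)‖ < k + 1)
    (hs : s ≠ 1) : hurwitzZetaFn s a =
      zetaTail k s + (a - (k + 1)) * taylorQuotient k s (a - (k + 1)) := by
  have h := isHurwitzContinuation_taylor k ha
  rw [add_sub_cancel] at h
  exact h.eq_hurwitzZetaFn hs

theorem isHurwitzContinuation_of_re_pos {a : ℂ} (ha : 0 < a.re) :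
    IsHurwitzContinuation a fun s => hurwitzZetaFn s a := by
  obtain ⟨k, hk⟩ := exists_norm_sub_lt ha
  have h := isHurwitzContinuation_taylor k hk
  rw [add_sub_cancel] at h
  exact h.isHurwitzContinuation_hurwitzZetaFn

theorem analyticAt_hurwitzZetaFn_of_re_pos {s a : ℂ} (hs : s ≠ 1) (ha : 0 < a.re) :
    AnalyticAt ℂ (fun z : ℂ × ℂ => hurwitzZetaFn z.1 z.2) (s, a) := by
  obtain ⟨k, hk⟩ := exists_norm_sub_lt ha
  have h1 : AnalyticAt ℂ (fun z : ℂ × ℂ => z.2 - ((k : ℂ) + 1)) (s, a) :=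
    analyticAt_snd.sub analyticAt_const
  have h2 : AnalyticAt ℂ (fun z : ℂ × ℂ => taylorQuotient k z.1 (z.2 - (k + 1))) (s, a) :=
    AnalyticAt.comp₂ (h := fun z : ℂ × ℂ => taylorQuotient k z.1 z.2)
      (analyticAt_taylorQuotient k s hk) analyticAt_fst h1
  have h3 : AnalyticAt ℂ (fun z : ℂ × ℂ => zetaTail k z.1) (s, a) :=
    AnalyticAt.comp_of_eq (g := zetaTail k)
      ((differentiableOn_zetaTail k).analyticAt (isOpen_compl_singleton.mem_nhds hs))
      analyticAt_fst rfl
  refine (h3.add (h1.mul h2)).congr ?_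
  have h4 : ∀ᶠ z : ℂ × ℂ in 𝓝 (s, a), z.1 ≠ 1 := continuousAt_fst.eventually_ne hs
  have h5 : ∀ᶠ z : ℂ × ℂ in 𝓝 (s, a), ‖z.2 - ((k : ℂ) + 1)‖ < k + 1 :=
    h1.continuousAt.norm.eventually_lt continuousAt_const hk
  filter_upwards [h4, h5] with z hz1 hz2
  exact (hurwitzZetaFn_eq_taylor hz2 hz1).symm

theorem tendsto_sub_one_mul_hurwitzZetaFn_of_re_pos {a : ℂ} (ha : 0 < a.re) :
    Tendsto (fun s => (s - 1) * hurwitzZetaFn s a) (𝓝[≠] 1) (𝓝 1) := by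
  obtain ⟨k, hk⟩ := exists_norm_sub_lt ha
  have h1 := (tendsto_sub_one_mul_zetaTail k).add (tendsto_sub_one_mul_of_continuousAt
    ((analyticAt_taylorQuotient k 1 hk).hasDerivAt_fst.const_mul
      (a - (k + 1))).continuousAt)
  rw [add_zero] at h1
  refine h1.congr' ?_
  filter_upwards [self_mem_nhdsWithin] with s hs
  rw [hurwitzZetaFn_eq_taylor hk hs]
  ring

end RightHalfPlane

/-! ### Avoiding the non-positive integers. -/

section NonposIntegers

theorem natCast_add_ne_zero {a : ℂ} (ha : a ∉ nonposIntegers) (n : ℕ) : (n : ℂ) + a ≠ 0 :=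
  fun h => ha ⟨n, by linear_combination h⟩

theorem not_mem_nonposIntegers_of_re_pos {a : ℂ} (ha : 0 < a.re) : a ∉ nonposIntegers := by
  rintro ⟨n, rfl⟩
  simp only [Complex.neg_re, Complex.natCast_re] at ha
  have : (0 : ℝ) ≤ n := by positivity
  linarith

theorem not_mem_nonposIntegers_of_mem_slitPlane {a : ℂ} (ha : a ∈ Complex.slitPlane) :
    a ∉ nonposIntegers := by
  rintro ⟨n, rfl⟩
  rcases ha with h | h
  · exact not_mem_nonposIntegers_of_re_pos h ⟨n, rfl⟩
  · simp at h

theorem exists_re_add_natCast_pos (a : ℂ) : ∃ K : ℕ, 0 < (a + K).re := by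
  obtain ⟨K, hK⟩ := exists_nat_gt (-a.re)
  exact ⟨K, by simp only [Complex.add_re, Complex.natCast_re]; linarith⟩

end NonposIntegers

/-! ### Shifting `α` into the right half-plane; the derivative in `α`. -/

section Shift

theorem differentiable_cpow_neg {x : ℂ} (hx : x ≠ 0) : Differentiable ℂ fun s : ℂ => x ^ (-s) :=
  fun _ => DifferentiableAt.const_cpow (by fun_prop) (Or.inl hx)

theorem isHurwitzContinuation_sum_add {a : ℂ} (ha : a ∉ nonposIntegers) {K : ℕ}
    (hK : 0 < (a + K).re) : IsHurwitzContinuation a fun s =>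
      ∑ n ∈ Finset.range K, ((n : ℂ) + a) ^ (-s) + hurwitzZetaFn s (a + K) := by
  have h := isHurwitzContinuation_of_re_pos hK
  refine ⟨DifferentiableOn.add (DifferentiableOn.fun_sum fun n _ =>
    (differentiable_cpow_neg (natCast_add_ne_zero ha n)).differentiableOn) h.1, fun s hs => ?_⟩
  rw [← hasSum_nat_add_iff' K, add_sub_cancel_left]
  refine (h.2 s hs).congr_fun fun n => ?_
  push_cast
  ring_nf

theorem isHurwitzContinuation_hurwitzZetaFn {a : ℂ} (ha : a ∉ nonposIntegers) :
    IsHurwitzContinuation a fun s => hurwitzZetaFn s a := by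
  obtain ⟨K, hK⟩ := exists_re_add_natCast_pos a
  exact (isHurwitzContinuation_sum_add ha hK).isHurwitzContinuation_hurwitzZetaFn

theorem hurwitzZetaFn_eq_sum_add {a s : ℂ} (ha : a ∉ nonposIntegers) {K : ℕ}
    (hK : 0 < (a + K).re) (hs : s ≠ 1) : hurwitzZetaFn s a =
      ∑ n ∈ Finset.range K, ((n : ℂ) + a) ^ (-s) + hurwitzZetaFn s (a + K) :=
  (isHurwitzContinuation_sum_add ha hK).eq_hurwitzZetaFn hs

theorem hurwitzZetaFn_add_one {a s : ℂ} (ha : 0 < a.re) (hs : s ≠ 1) :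
    hurwitzZetaFn s a = a ^ (-s) + hurwitzZetaFn s (a + 1) := by
  have h := hurwitzZetaFn_eq_sum_add (K := 1) (not_mem_nonposIntegers_of_re_pos ha)
    (by simp; linarith) hs
  simpa using h

theorem hurwitzZetaFn_one_right {s : ℂ} (hs : s ≠ 1) : hurwitzZetaFn s 1 = riemannZeta s := by
  have h : IsHurwitzContinuation 1 riemannZeta := by
    refine ⟨fun s hs => (differentiableAt_riemannZeta hs).differentiableWithinAt, fun s hs => ?_⟩
    have h1 : Summable fun n : ℕ => ((n : ℂ) + 1) ^ (-s) :=
      summable_natCast_add_cpow_neg hs (by simp)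
    rw [zeta_eq_tsum_one_div_nat_add_one_cpow hs]
    convert h1.hasSum using 4 with n
    rw [Complex.cpow_neg, one_div]
  exact h.eq_hurwitzZetaFn hs

theorem hurwitzZetaFn_eq_hurwitzSeries {s a : ℂ} (hs : 1 < s.re) (ha : a ∉ nonposIntegers) :
    hurwitzZetaFn s a = hurwitzSeries s a :=
  ((isHurwitzContinuation_hurwitzZetaFn ha).2 s hs).tsum_eq.symm

/-- Termwise differentiation proves it for `Re s > 1`. Both sides are analytic in `s ≠ 1`, so the
identity theorem extends it; the value `1` at `s = 0` comes from the residue. -/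
theorem hasDerivAt_hurwitzZetaFn {s a : ℂ} (hs : s ≠ 1) (ha : 0 < a.re) :
    HasDerivAt (fun b => hurwitzZetaFn s b)
      (-(if s = 0 then 1 else s * hurwitzZetaFn (s + 1) a)) a := by
  set f : ℂ × ℂ → ℂ := fun z => hurwitzZetaFn z.1 z.2 with hf
  have hfa : ∀ w : ℂ, w ≠ 1 → AnalyticAt ℂ f (w, a) := fun w hw =>
    analyticAt_hurwitzZetaFn_of_re_pos hw ha
  set D : ℂ → ℂ := fun w => fderiv ℂ f (w, a) (0, 1) with hD
  have hDa : AnalyticOnNhd ℂ D {1}ᶜ := fun w hw =>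
    AnalyticAt.comp_of_eq (g := fun z => fderiv ℂ f z (0, 1)) ((hfa w hw).fderiv_apply (0, 1))
      (analyticAt_id.prod analyticAt_const) rfl
  have hG : Differentiable ℂ fun w : ℂ => -(if w = 0 then 1 else w * hurwitzZetaFn (w + 1) a) :=
    (differentiable_mul_translate (isHurwitzContinuation_of_re_pos ha).1
      (tendsto_sub_one_mul_hurwitzZetaFn_of_re_pos ha)).neg
  have hpre : IsPreconnected ({1}ᶜ : Set ℂ) :=
    (isConnected_compl_singleton_of_one_lt_rank (by simp) 1).isPreconnected
  have hopen : {w : ℂ | 1 < w.re} ∈ 𝓝 (2 : ℂ) :=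
    (isOpen_lt continuous_const Complex.continuous_re).mem_nhds (by simp)
  have heq := AnalyticOnNhd.eqOn_of_preconnected_of_eventuallyEq hDa
    (fun w _ => hG.analyticAt w) hpre (z₀ := 2) (by norm_num) (by
      filter_upwards [hopen] with w hw
      have hw1 : w ≠ 1 := by rintro rfl; simp at hw
      have hw0 : w ≠ 0 := by
        rintro rfl
        simp only [Complex.zero_re] at hw
        linarith
      have hw2 : 1 < (w + 1).re := by
        simp only [Complex.add_re, Complex.one_re] at hw ⊢
        linarith
      rw [if_neg hw0, hurwitzZetaFn_eq_hurwitzSeries hw2 (not_mem_nonposIntegers_of_re_pos ha),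
        ← neg_mul]
      refine ((hfa w hw1).hasDerivAt_snd).unique
        ((hasDerivAt_hurwitzSeries hw ha).congr_of_eventuallyEq ?_)
      filter_upwards [(isOpen_lt continuous_const Complex.continuous_re).mem_nhds ha] with b hb
      exact hurwitzZetaFn_eq_hurwitzSeries hw (not_mem_nonposIntegers_of_re_pos hb))
  have h : D s = -(if s = 0 then 1 else s * hurwitzZetaFn (s + 1) a) := heq hs
  rw [← h]
  exact (hfa s hs).hasDerivAt_snd

end Shift

/-! ### Lerch's formula for `ζ'(0, α)`, by Bohr–Mollerup. -/

section Lerch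

/-- For real `x > 0` the conjugated function continues the same series, so uniqueness applies. -/
theorem conj_hurwitzZetaFn {x : ℝ} (hx : 0 < x) {s : ℂ} (hs : s ≠ 1) :
    (starRingEnd ℂ) (hurwitzZetaFn ((starRingEnd ℂ) s) x) = hurwitzZetaFn s x := by
  have hc := isHurwitzContinuation_of_re_pos (a := (x : ℂ)) (by simpa using hx)
  have h : IsHurwitzContinuation (x : ℂ)
      (fun s => (starRingEnd ℂ) (hurwitzZetaFn ((starRingEnd ℂ) s) x)) := by
    refine ⟨fun s hs => ?_, fun s hs => ?_⟩
    · have hs' : (starRingEnd ℂ) s ≠ 1 := by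
        intro h1
        apply hs
        have := congrArg (starRingEnd ℂ) h1
        simpa using this
      have h1 : DifferentiableAt ℂ (fun s => hurwitzZetaFn s x) ((starRingEnd ℂ) s) :=
        hc.1.differentiableAt (isOpen_compl_singleton.mem_nhds hs')
      have h2 := h1.hasDerivAt.conj_conj
      rw [Complex.conj_conj] at h2
      exact h2.differentiableAt.differentiableWithinAt
    · have h1 := hc.2 ((starRingEnd ℂ) s) (by simpa using hs)
      have h2 := h1.mapL (Complex.conjCLE : ℂ →L[ℝ] ℂ)
      refine h2.congr_fun fun n => ?_
      have hpos : (0 : ℝ) < n + x := by positivity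
      have hr : (n : ℂ) + (x : ℂ) = ((n + x : ℝ) : ℂ) := by push_cast; rfl
      rw [hr]
      change _ = (starRingEnd ℂ) _
      rw [← map_neg, Complex.cpow_conj _ _ (by
        rw [Complex.arg_ofReal_of_nonneg hpos.le]; exact Real.pi_pos.ne), Complex.conj_conj,
        Complex.conj_ofReal]
  exact (h.eq_hurwitzZetaFn hs).symm

/-- `ζ'(0, a)`. -/
noncomputable def lerchFn (a : ℂ) : ℂ := sDeriv hurwitzZetaFn 1 0 a

theorem analyticAt_sDeriv {Z : ℂ → ℂ → ℂ} {s a : ℂ}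
    (hZ : AnalyticAt ℂ (fun z : ℂ × ℂ => Z z.1 z.2) (s, a)) (r : ℕ) :
    AnalyticAt ℂ (fun z : ℂ × ℂ => sDeriv Z r z.1 z.2) (s, a) :=
  analyticAt_iteratedDeriv_fst hZ r

theorem analyticAt_sDeriv_snd {Z : ℂ → ℂ → ℂ} {s a : ℂ}
    (hZ : AnalyticAt ℂ (fun z : ℂ × ℂ => Z z.1 z.2) (s, a)) (r : ℕ) :
    AnalyticAt ℂ (fun b : ℂ => sDeriv Z r s b) a :=
  AnalyticAt.comp_of_eq (g := fun z : ℂ × ℂ => sDeriv Z r z.1 z.2) (analyticAt_sDeriv hZ r)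
    (analyticAt_const.prod analyticAt_id) rfl

theorem analyticAt_lerchFn {a : ℂ} (ha : 0 < a.re) : AnalyticAt ℂ lerchFn a :=
  analyticAt_sDeriv_snd (analyticAt_hurwitzZetaFn_of_re_pos zero_ne_one ha) 1

theorem hasDerivAt_cpow_neg {x : ℂ} (hx : x ≠ 0) (s : ℂ) :
    HasDerivAt (fun w : ℂ => x ^ (-w)) (-Complex.log x * x ^ (-s)) s := by
  have h := (hasDerivAt_neg s).const_cpow (c := x) (Or.inl hx)
  convert h using 1
  ring

theorem lerchFn_add_one {a : ℂ} (ha : 0 < a.re) : lerchFn (a + 1) = lerchFn a + Complex.log a := by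
  have ha0 : a ≠ 0 := by rintro rfl; simp at ha
  have h1 : (fun s => hurwitzZetaFn s a) =ᶠ[𝓝 0] fun s => a ^ (-s) + hurwitzZetaFn s (a + 1) := by
    filter_upwards [isOpen_compl_singleton.mem_nhds
      (show (0 : ℂ) ∈ ({1}ᶜ : Set ℂ) by simp)] with s hs
    exact hurwitzZetaFn_add_one ha hs
  have ha1 : 0 < (a + 1).re := by simp; linarith
  have h2 : HasDerivAt (fun s => hurwitzZetaFn s (a + 1)) (lerchFn (a + 1)) 0 := by
    have := (analyticAt_hurwitzZetaFn_of_re_pos zero_ne_one ha1).hasDerivAt_fst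
    rw [lerchFn, sDeriv, iteratedDeriv_one]
    exact this.differentiableAt.hasDerivAt
  have h3 := (hasDerivAt_cpow_neg ha0 0).fun_add h2
  rw [neg_zero, Complex.cpow_zero, mul_one] at h3
  have h4 : lerchFn a = -Complex.log a + lerchFn (a + 1) := by
    rw [lerchFn, sDeriv, iteratedDeriv_one, h1.deriv_eq]
    exact h3.deriv
  rw [h4]
  ring

theorem lerchFn_one : lerchFn 1 = -Complex.log (2 * Real.pi) / 2 := by
  have h1 : (fun s => hurwitzZetaFn s 1) =ᶠ[𝓝 0] riemannZeta := by
    filter_upwards [isOpen_compl_singleton.mem_nhds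
      (show (0 : ℂ) ∈ ({1}ᶜ : Set ℂ) by simp)] with s hs
    exact hurwitzZetaFn_one_right hs
  rw [lerchFn, sDeriv, iteratedDeriv_one, h1.deriv_eq, deriv_riemannZeta_zero]

theorem conj_lerchFn {x : ℝ} (hx : 0 < x) : (starRingEnd ℂ) (lerchFn x) = lerchFn x := by
  have hx' : 0 < (x : ℂ).re := by simpa using hx
  have h1 := (analyticAt_hurwitzZetaFn_of_re_pos zero_ne_one
    hx').hasDerivAt_fst.differentiableAt.hasDerivAt
  have h2 : HasDerivAt (fun s => hurwitzZetaFn s x) (lerchFn x) ((starRingEnd ℂ) 0) := by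
    rw [map_zero, lerchFn, sDeriv, iteratedDeriv_one]
    exact h1
  have h3 := h2.conj_conj
  rw [Complex.conj_conj] at h3
  have h4 : (fun s => hurwitzZetaFn s x) =ᶠ[𝓝 0]
      (starRingEnd ℂ) ∘ (fun s => hurwitzZetaFn s x) ∘ (starRingEnd ℂ) := by
    filter_upwards [isOpen_compl_singleton.mem_nhds
      (show (0 : ℂ) ∈ ({1}ᶜ : Set ℂ) by simp)] with s hs
    exact (conj_hurwitzZetaFn hx hs).symm
  have h5 := h3.congr_of_eventuallyEq h4
  rw [map_zero] at h2
  exact h5.unique h2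

/-- `∂²/∂a² ζ'(0, a) = ζ(2, a)`. -/
theorem iteratedDeriv_two_lerchFn {a : ℂ} (ha : 0 < a.re) :
    iteratedDeriv 2 lerchFn a = hurwitzZetaFn 2 a := by
  have h1 := iteratedDeriv_comm (analyticAt_hurwitzZetaFn_of_re_pos zero_ne_one ha) 2 1
  have h2 : (fun w => iteratedDeriv 2 (fun b => hurwitzZetaFn w b) a) =ᶠ[𝓝 0]
      fun w => w * ((w + 1) * hurwitzZetaFn (w + 2) a) := by
    -- Two derivatives in `a` produce `w (w + 1) ζ(w + 2, a)`, whose `w`-derivative at `0` is `ζ(2,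
    -- a)`. Excluding `w = -1` keeps the second differentiation away from its special case `w + 1 =
    -- 0`.
    filter_upwards [isOpen_compl_singleton.mem_nhds
      (show (0 : ℂ) ∈ ({1}ᶜ : Set ℂ) by simp), isOpen_compl_singleton.mem_nhds
      (show (0 : ℂ) ∈ ({-1}ᶜ : Set ℂ) by simp)] with w hw hw'
    rw [iteratedDeriv_succ, iteratedDeriv_one]
    have h3 : deriv (fun b => hurwitzZetaFn w b) =ᶠ[𝓝 a] fun b =>
        -(if w = 0 then 1 else w * hurwitzZetaFn (w + 1) b) := by
      filter_upwards [(isOpen_lt continuous_const Complex.continuous_re).mem_nhds ha] with b hb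
      exact (hasDerivAt_hurwitzZetaFn hw hb).deriv
    rw [h3.deriv_eq]
    rcases eq_or_ne w 0 with rfl | hw0
    · simp
    · simp only [if_neg hw0]
      have hw1 : w + 1 ≠ 1 := by simpa using hw0
      have hw2 : w + 1 ≠ 0 := fun h => hw' (by
        rw [Set.mem_singleton_iff]; linear_combination h)
      have h4 := (hasDerivAt_hurwitzZetaFn hw1 ha).const_mul w
      rw [if_neg hw2] at h4
      rw [h4.fun_neg.deriv, show w + 1 + 1 = w + 2 by ring]
      ring
  have h5 : HasDerivAt (fun w => w * ((w + 1) * hurwitzZetaFn (w + 2) a))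
      (hurwitzZetaFn 2 a) 0 := by
    have h6 : DifferentiableAt ℂ (fun w => (w + 1) * hurwitzZetaFn (w + 2) a) 0 := by
      have h7 : DifferentiableAt ℂ (fun w => hurwitzZetaFn w a) (0 + 2) :=
        (isHurwitzContinuation_of_re_pos ha).1.differentiableAt
          (isOpen_compl_singleton.mem_nhds (by norm_num))
      exact DifferentiableAt.mul (by fun_prop)
        (DifferentiableAt.comp (g := fun w => hurwitzZetaFn w a) (f := fun w => w + 2)
          (0 : ℂ) h7 (by fun_prop))
    have h8 := (hasDerivAt_id (0 : ℂ)).fun_mul h6.hasDerivAt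
    simpa using h8
  have h9 : lerchFn = fun b => iteratedDeriv 1 (fun w => hurwitzZetaFn w b) 0 := rfl
  rw [h9]
  refine h1.trans ?_
  rw [iteratedDeriv_one, h2.deriv_eq]
  exact h5.deriv

theorem hasDerivAt_deriv_lerchFn {a : ℂ} (ha : 0 < a.re) :
    HasDerivAt (deriv lerchFn) (hurwitzZetaFn 2 a) a := by
  have h := (analyticAt_lerchFn ha).deriv.differentiableAt.hasDerivAt
  rwa [← iteratedDeriv_two_lerchFn ha, iteratedDeriv_succ, iteratedDeriv_one]

theorem hurwitzZetaFn_two_re_nonneg {x : ℝ} (hx : 0 < x) : 0 ≤ (hurwitzZetaFn 2 x).re := by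
  have h := (isHurwitzContinuation_of_re_pos (a := (x : ℂ)) (by simpa using hx)).2 2 (by simp)
  refine (Complex.hasSum_re h).nonneg fun n => ?_
  have hpos : (0 : ℝ) ≤ n + x := by positivity
  have hr : (n : ℂ) + (x : ℂ) = ((n + x : ℝ) : ℂ) := by push_cast; rfl
  have h2 : (-2 : ℂ) = ((-2 : ℝ) : ℂ) := by push_cast; rfl
  rw [hr, h2, ← Complex.ofReal_cpow hpos, Complex.ofReal_re]
  positivity

theorem convexOn_re_lerchFn : ConvexOn ℝ (Set.Ioi 0) fun x : ℝ => (lerchFn x).re := by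
  have h1 : ∀ x : ℝ, 0 < x → HasDerivAt (fun x : ℝ => (lerchFn x).re) (deriv lerchFn x).re x :=
    fun x hx => (analyticAt_lerchFn (a := (x : ℂ))
      (by simpa using hx)).differentiableAt.hasDerivAt.real_of_complex
  have h2 : ∀ x : ℝ, 0 < x →
      HasDerivAt (fun x : ℝ => (deriv lerchFn x).re) (hurwitzZetaFn 2 x).re x :=
    fun x hx => (hasDerivAt_deriv_lerchFn (a := (x : ℂ)) (by simpa using hx)).real_of_complex
  refine convexOn_of_hasDerivWithinAt2_nonneg (convex_Ioi 0)
    (fun x hx => (h1 x hx).continuousAt.continuousWithinAt)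
    (f' := fun x => (deriv lerchFn x).re) (f'' := fun x => (hurwitzZetaFn 2 x).re) ?_ ?_ ?_
  · intro x hx
    rw [interior_Ioi] at hx
    exact (h1 x hx).hasDerivWithinAt
  · intro x hx
    rw [interior_Ioi] at hx
    exact (h2 x hx).hasDerivWithinAt
  · intro x hx
    rw [interior_Ioi] at hx
    exact hurwitzZetaFn_two_re_nonneg hx

theorem exp_lerchFn_one : Complex.exp (lerchFn 1) = 1 / (Real.sqrt (2 * Real.pi) : ℂ) := by
  have hp : (0 : ℝ) < 2 * Real.pi := by positivity
  have h1 : lerchFn 1 = ((-(Real.log (2 * Real.pi) / 2) : ℝ) : ℂ) := by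
    rw [lerchFn_one]
    push_cast
    rw [Complex.ofReal_log hp.le]
    push_cast
    ring
  rw [h1, ← Complex.ofReal_exp, Real.exp_neg, ← Real.log_sqrt hp.le,
    Real.exp_log (Real.sqrt_pos.2 hp)]
  simp

/-- By `conj_lerchFn` the values on the positive axis are real. Normalised to `1` at `1`, `exp ζ'(0,
x)` is log-convex since `ζ(2, x) ≥ 0`, and satisfies the functional equation of `Γ`; Bohr–Mollerup
identifies it. -/
theorem exp_lerchFn_ofReal {x : ℝ} (hx : 0 < x) :
    Complex.exp (lerchFn x) = Complex.Gamma x * Complex.exp (lerchFn 1) := by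
  have hreal : ∀ y : ℝ, 0 < y → lerchFn y = ((lerchFn y).re : ℂ) := fun y hy =>
    (Complex.conj_eq_iff_re.1 (conj_lerchFn hy)).symm
  have key : Set.EqOn (fun x : ℝ => Real.exp ((lerchFn x).re - (lerchFn 1).re)) Real.Gamma
      (Set.Ioi 0) := by
    refine Real.eq_Gamma_of_log_convex ?_ ?_ ?_ ?_
    · have h : (Real.log ∘ fun x : ℝ => Real.exp ((lerchFn x).re - (lerchFn 1).re)) =
          fun x : ℝ => (lerchFn x).re + (-(lerchFn 1).re) := by
        ext y
        simp [sub_eq_add_neg]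
      rw [h]
      exact convexOn_re_lerchFn.add_const _
    · intro y hy
      have h1 : lerchFn ((y + 1 : ℝ) : ℂ) = lerchFn y + Complex.log y := by
        rw [Complex.ofReal_add, Complex.ofReal_one]
        exact lerchFn_add_one (by simpa using hy)
      change Real.exp _ = y * Real.exp _
      rw [h1, Complex.add_re, Complex.log_ofReal_re, show (lerchFn y).re + Real.log y -
        (lerchFn 1).re = Real.log y + ((lerchFn y).re - (lerchFn 1).re) by ring, Real.exp_add,
        Real.exp_log hy]
    · intro y _
      exact Real.exp_pos _
    · simp
  have h2 := key hx
  have h3 := hreal 1 one_pos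
  rw [Complex.ofReal_one] at h3
  rw [hreal x hx, h3, Complex.Gamma_ofReal, ← h2, ← Complex.ofReal_exp, ← Complex.ofReal_exp,
    ← Complex.ofReal_mul, ← Real.exp_add]
  congr 2
  ring

/-- Lerch's formula on the right half-plane. -/
theorem exp_lerchFn {a : ℂ} (ha : 0 < a.re) :
    Complex.exp (lerchFn a) = Complex.Gamma a / (Real.sqrt (2 * Real.pi) : ℂ) := by
  rw [div_eq_mul_one_div, ← exp_lerchFn_one]
  have hopen : IsOpen {b : ℂ | 0 < b.re} := isOpen_lt continuous_const Complex.continuous_re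
  have hpre : IsPreconnected {b : ℂ | 0 < b.re} := (convex_halfSpace_re_gt 0).isPreconnected
  have hf : AnalyticOnNhd ℂ (fun b => Complex.exp (lerchFn b)) {b : ℂ | 0 < b.re} :=
    fun b hb => (analyticAt_lerchFn hb).cexp
  have hg : AnalyticOnNhd ℂ (fun b => Complex.Gamma b * Complex.exp (lerchFn 1))
      {b : ℂ | 0 < b.re} := by
    refine DifferentiableOn.analyticOnNhd (fun b hb => ?_) hopen
    refine ((Complex.differentiableAt_Gamma b fun m hm => ?_).mul_const _).differentiableWithinAt
    exact not_mem_nonposIntegers_of_re_pos hb ⟨m, hm⟩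
  -- The real points to the right of `1` accumulate at `1`, which suffices for the identity theorem.
  refine AnalyticOnNhd.eqOn_of_preconnected_of_frequently_eq hf hg hpre (z₀ := 1) (by simp) ?_ ha
  have ht : Tendsto (fun x : ℝ => (x : ℂ)) (𝓝[>] 1) (𝓝[≠] 1) := by
    refine tendsto_nhdsWithin_iff.2 ⟨?_, ?_⟩
    · have := Complex.continuous_ofReal.tendsto 1
      rw [Complex.ofReal_one] at this
      exact this.mono_left nhdsWithin_le_nhds
    · filter_upwards [self_mem_nhdsWithin] with x hx
      simpa using (ne_of_gt hx)
  refine ht.frequently (Eventually.frequently ?_)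
  filter_upwards [self_mem_nhdsWithin] with x hx
  exact exp_lerchFn_ofReal (one_pos.trans hx)

end Lerch

/-! ### The pole at `s = 1` for general `α`, and the Laurent coefficients. -/

section Residues

theorem tendsto_sub_one_mul_hurwitzZetaFn {a : ℂ} (ha : a ∉ nonposIntegers) :
    Tendsto (fun s => (s - 1) * hurwitzZetaFn s a) (𝓝[≠] 1) (𝓝 1) := by
  obtain ⟨K, hK⟩ := exists_re_add_natCast_pos a
  have h1 : Differentiable ℂ fun s : ℂ => ∑ n ∈ Finset.range K, ((n : ℂ) + a) ^ (-s) :=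
    Differentiable.fun_sum fun n _ => differentiable_cpow_neg (natCast_add_ne_zero ha n)
  have h2 := (tendsto_sub_one_mul_of_continuousAt (h1 1).continuousAt).add
    (tendsto_sub_one_mul_hurwitzZetaFn_of_re_pos hK)
  rw [zero_add] at h2
  refine h2.congr' ?_
  filter_upwards [self_mem_nhdsWithin] with s hs
  rw [hurwitzZetaFn_eq_sum_add ha hK hs]
  ring

theorem laurentGamma_neg_one (Z : ℂ → ℂ → ℂ) (a : ℂ) : laurentGamma Z (-1) a = 1 := by
  simp [laurentGamma]

theorem laurentGamma_natCast_sub_one (Z : ℂ → ℂ → ℂ) (r : ℕ) (a : ℂ) :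
    laurentGamma Z ((r : ℤ) - 1) a =
      iteratedDeriv r (fun s : ℂ => if s = 0 then 1 else s * Z (s + 1) a) 0 / (r.factorial : ℂ) := by
  rw [laurentGamma, if_neg (by omega)]
  simp

theorem laurentGamma_natCast (Z : ℂ → ℂ → ℂ) (n : ℕ) (a : ℂ) :
    laurentGamma Z n a = iteratedDeriv (n + 1)
      (fun s : ℂ => if s = 0 then 1 else s * Z (s + 1) a) 0 / ((n + 1).factorial : ℂ) := by
  have h := laurentGamma_natCast_sub_one Z (n + 1) a
  rwa [Nat.cast_add, Nat.cast_one, add_sub_cancel_right] at h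

theorem laurentGamma_congr {Z W : ℂ → ℂ → ℂ} {a : ℂ} (h : ∀ s, s ≠ 1 → Z s a = W s a) (n : ℤ) :
    laurentGamma Z n a = laurentGamma W n a := by
  have h1 : (fun s : ℂ => if s = 0 then 1 else s * Z (s + 1) a) =
      fun s : ℂ => if s = 0 then 1 else s * W (s + 1) a := by
    ext s
    split_ifs with hs
    · rfl
    · rw [h _ (by simpa using hs)]
  rw [laurentGamma, laurentGamma, h1]

theorem hasSum_laurentGamma {Z : ℂ → ℂ → ℂ} {a : ℂ}
    (hd : DifferentiableOn ℂ (fun s => Z s a) {1}ᶜ)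
    (hres : Tendsto (fun s => (s - 1) * Z s a) (𝓝[≠] 1) (𝓝 1)) {s : ℂ} (hs : s ≠ 0) :
    HasSum (fun n : ℕ => laurentGamma Z n a * s ^ n) (Z (s + 1) a - 1 / s) := by
  simp only [laurentGamma_natCast]
  exact hasSum_laurent hd hres hs

end Residues

/-! ### Local description of branches by finitely many logarithms. -/

section LogSystem

theorem eq_of_exp_eq_of_norm_sub_lt {x y : ℂ} (h : Complex.exp x = Complex.exp y)
    (hxy : ‖x - y‖ < 2 * Real.pi) : x = y := by
  obtain ⟨n, hn⟩ := Complex.exp_eq_exp_iff_exists_int.1 h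
  have h1 : x - y = n * (2 * Real.pi * Complex.I) := by rw [hn]; ring
  have h2 : ‖x - y‖ = |(n : ℝ)| * (2 * Real.pi) := by
    rw [h1, norm_mul, Complex.norm_intCast]
    simp [abs_of_pos Real.pi_pos]
  rw [h2] at hxy
  have h3 : |(n : ℝ)| < 1 := by
    have := Real.pi_pos
    nlinarith
  have h4 : n = 0 := by
    have : |n| < 1 := by exact_mod_cast h3
    exact Int.abs_lt_one_iff.1 this
  rw [hn, h4]
  simp

/-- Two logarithms of one number differ by a multiple of `2πi`; by continuity the difference stays
below `2π` near `a`, hence is `0`. -/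
theorem eventuallyEq_of_exp_eq {X : Type*} [TopologicalSpace X] {f g : X → ℂ} {a : X}
    (hf : ContinuousAt f a) (hg : ContinuousAt g a)
    (h : ∀ᶠ b in 𝓝 a, Complex.exp (f b) = Complex.exp (g b)) (hfg : f a = g a) : f =ᶠ[𝓝 a] g := by
  have h1 : ∀ᶠ b in 𝓝 a, ‖f b - g b‖ < 2 * Real.pi := by
    refine (hf.sub hg).norm.eventually_lt continuousAt_const ?_
    simp [hfg, Real.pi_pos]
  filter_upwards [h, h1] with b hb1 hb2
  exact eq_of_exp_eq_of_norm_sub_lt hb1 hb2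

/-- The branch of the logarithm near `w` with value `c` at `w`, where `exp c = w`. -/
noncomputable def logNear (w c b : ℂ) : ℂ := Complex.log (b / w) + c

theorem logNear_self {w : ℂ} (hw : w ≠ 0) (c : ℂ) : logNear w c w = c := by
  simp [logNear, div_self hw]

theorem analyticAt_logNear {w c b : ℂ} (hb : b / w ∈ Complex.slitPlane) :
    AnalyticAt ℂ (logNear w c) b :=
  ((analyticAt_id.div_const).clog hb).add analyticAt_const

theorem exp_logNear {w c b : ℂ} (hc : Complex.exp c = w) (hb : b ≠ 0) :
    Complex.exp (logNear w c b) = b := by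
  have hw : w ≠ 0 := hc ▸ Complex.exp_ne_zero c
  rw [logNear, Complex.exp_add, Complex.exp_log (div_ne_zero hb hw), hc, div_mul_cancel₀ _ hw]

/-- `ℓ n`, `n < K`, are analytic branches of `log (n + ·)` near `a`, and `a + K` lies in the right
half-plane. -/
structure IsLogSystemAt (K : ℕ) (ℓ : ℕ → ℂ → ℂ) (a : ℂ) : Prop where
  re_pos : 0 < (a + K).re
  analyticAt : ∀ n < K, AnalyticAt ℂ (ℓ n) a
  exp_eq : ∀ n < K, ∀ᶠ b in 𝓝 a, Complex.exp (ℓ n b) = n + b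

/-- `∑_{n < K} (n + a)^(-s) + ζ(s, a + K)`, with powers given by the logarithms `ℓ n`. -/
noncomputable def logSum (K : ℕ) (ℓ : ℕ → ℂ → ℂ) (s a : ℂ) : ℂ :=
  ∑ n ∈ Finset.range K, Complex.exp (-(s * ℓ n a)) + hurwitzZetaFn s (a + K)

variable {K : ℕ} {ℓ : ℕ → ℂ → ℂ} {a : ℂ}

theorem IsLogSystemAt.not_mem (h : IsLogSystemAt K ℓ a) : a ∉ nonposIntegers := by
  rintro ⟨n, rfl⟩
  rcases lt_or_ge n K with hn | hn
  · have := (h.exp_eq n hn).self_of_nhds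
    rw [add_neg_cancel] at this
    exact Complex.exp_ne_zero _ this
  · have h1 := h.re_pos
    simp only [Complex.add_re, Complex.neg_re, Complex.natCast_re] at h1
    have : (K : ℝ) ≤ n := by exact_mod_cast hn
    linarith

theorem IsLogSystemAt.eventually (h : IsLogSystemAt K ℓ a) :
    ∀ᶠ b in 𝓝 a, IsLogSystemAt K ℓ b := by
  have h1 : ∀ᶠ b : ℂ in 𝓝 a, 0 < (b + K).re :=
    continuousAt_const.eventually_lt (by fun_prop) h.re_pos
  have h2 : ∀ᶠ b in 𝓝 a, ∀ n ∈ Finset.range K, AnalyticAt ℂ (ℓ n) b :=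
    (eventually_all_finset _).2 fun n hn =>
      (h.analyticAt n (Finset.mem_range.1 hn)).eventually_analyticAt
  have h3 : ∀ᶠ b in 𝓝 a, ∀ n ∈ Finset.range K, ∀ᶠ c in 𝓝 b, Complex.exp (ℓ n c) = n + c :=
    (eventually_all_finset _).2 fun n hn =>
      (h.exp_eq n (Finset.mem_range.1 hn)).eventually_nhds
  filter_upwards [h1, h2, h3] with b hb1 hb2 hb3
  exact ⟨hb1, fun n hn => hb2 n (Finset.mem_range.2 hn), fun n hn => hb3 n (Finset.mem_range.2 hn)⟩

/-- The values `c n` may be any logarithms of `n + a`; this freedom is what lets the system follow a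
path. -/
theorem isLogSystemAt_logNear (ha : a ∉ nonposIntegers) (hK : 0 < (a + K).re) (c : ℕ → ℂ)
    (hc : ∀ n, Complex.exp (c n) = n + a) :
    IsLogSystemAt K (fun n b => logNear ((n : ℂ) + a) (c n) (n + b)) a := by
  refine ⟨hK, fun n _ => ?_, fun n _ => ?_⟩
  · refine AnalyticAt.comp_of_eq (g := logNear ((n : ℂ) + a) (c n)) (f := fun b => (n : ℂ) + b)
      (analyticAt_logNear (b := (n : ℂ) + a) ?_) (by fun_prop) rfl
    rw [div_self (natCast_add_ne_zero ha n)]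
    exact Complex.one_mem_slitPlane
  · have h1 : ∀ᶠ b : ℂ in 𝓝 a, (n : ℂ) + b ≠ 0 :=
      ContinuousAt.eventually_ne (by fun_prop) (natCast_add_ne_zero ha n)
    filter_upwards [h1] with b hb
    exact exp_logNear (hc n) hb

theorem analyticAt_hurwitzZetaFn_add {s : ℂ} (hK : 0 < (a + K).re) (hs : s ≠ 1) :
    AnalyticAt ℂ (fun z : ℂ × ℂ => hurwitzZetaFn z.1 (z.2 + K)) (s, a) :=
  AnalyticAt.comp₂ (h := fun z : ℂ × ℂ => hurwitzZetaFn z.1 z.2)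
    (analyticAt_hurwitzZetaFn_of_re_pos hs hK) analyticAt_fst
    (analyticAt_snd.add analyticAt_const)

theorem IsLogSystemAt.analyticAt_logSum (h : IsLogSystemAt K ℓ a) {s : ℂ} (hs : s ≠ 1) :
    AnalyticAt ℂ (fun z : ℂ × ℂ => logSum K ℓ z.1 z.2) (s, a) := by
  refine AnalyticAt.add (Finset.analyticAt_fun_sum _ fun n hn => ?_)
    (analyticAt_hurwitzZetaFn_add h.re_pos hs)
  exact (analyticAt_fst.mul (AnalyticAt.comp_of_eq (g := ℓ n)
    (h.analyticAt n (Finset.mem_range.1 hn)) analyticAt_snd rfl)).neg.cexp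

/-- The derivative `1 / (n + a)` is written as an exponential so that it raises `s` to `s + 1` in
`exp (-(s * ℓ n a))`. -/
theorem IsLogSystemAt.hasDerivAt_log (h : IsLogSystemAt K ℓ a) {n : ℕ} (hn : n < K) :
    HasDerivAt (ℓ n) (Complex.exp (-ℓ n a)) a := by
  have h1 := (h.analyticAt n hn).differentiableAt.hasDerivAt
  have h2 : HasDerivAt (fun b => Complex.exp (ℓ n b)) 1 a :=
    ((hasDerivAt_id a).const_add (n : ℂ)).congr_of_eventuallyEq (h.exp_eq n hn)
  have h3 := h1.cexp.unique h2
  have h4 : deriv (ℓ n) a = Complex.exp (-ℓ n a) := by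
    rw [Complex.exp_neg]
    exact eq_inv_of_mul_eq_one_right h3
  rwa [h4] at h1

theorem IsLogSystemAt.hasDerivAt_logSum (h : IsLogSystemAt K ℓ a) {s : ℂ} (hs : s ≠ 1) :
    HasDerivAt (fun b => logSum K ℓ s b)
      (-(if s = 0 then 1 else s * logSum K ℓ (s + 1) a)) a := by
  have h1 : ∀ n ∈ Finset.range K, HasDerivAt (fun b => Complex.exp (-(s * ℓ n b)))
      (-(s * Complex.exp (-((s + 1) * ℓ n a)))) a := by
    intro n hn
    have h2 := ((h.hasDerivAt_log (Finset.mem_range.1 hn)).const_mul s).fun_neg.cexp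
    refine h2.congr_deriv ?_
    rw [show -((s + 1) * ℓ n a) = -(s * ℓ n a) + -ℓ n a by ring, Complex.exp_add]
    ring
  have h3 : HasDerivAt (fun b => hurwitzZetaFn s (b + K))
      (-(if s = 0 then 1 else s * hurwitzZetaFn (s + 1) (a + K))) a := by
    have h4 := (hasDerivAt_hurwitzZetaFn hs h.re_pos).comp_add_const a (K : ℂ)
    exact h4
  have h5 := (HasDerivAt.fun_sum h1).fun_add h3
  refine h5.congr_deriv ?_
  split_ifs with h0
  · simp [h0]
  · rw [logSum, Finset.sum_neg_distrib, ← Finset.mul_sum]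
    ring

theorem Gamma_add_natCast (ha : a ∉ nonposIntegers) (K : ℕ) :
    Complex.Gamma (a + K) = (∏ n ∈ Finset.range K, ((n : ℂ) + a)) * Complex.Gamma a := by
  induction K with
  | zero => simp
  | succ K ih =>
    have h := natCast_add_ne_zero ha K
    rw [add_comm] at h
    rw [Nat.cast_add, Nat.cast_one, ← add_assoc, Complex.Gamma_add_one _ h, ih,
      Finset.prod_range_succ]
    ring

/-- The derivative at `s = 0` is `-∑ ℓ n a + ζ'(0, a + K)`. Exponentiation forgets which logarithms
were chosen and leaves `Γ(a + K) / ∏ (n + a)`, up to the factor `√(2π)`. -/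
theorem IsLogSystemAt.exp_sDeriv (h : IsLogSystemAt K ℓ a) :
    Complex.exp (sDeriv (logSum K ℓ) 1 0 a) =
      Complex.Gamma a / (Real.sqrt (2 * Real.pi) : ℂ) := by
  have h1 : ∀ n ∈ Finset.range K, HasDerivAt (fun s => Complex.exp (-(s * ℓ n a)))
      (-ℓ n a) 0 := by
    intro n _
    have h2 := ((hasDerivAt_id (0 : ℂ)).mul_const (ℓ n a)).fun_neg.cexp
    simpa using h2
  have h3 : HasDerivAt (fun s => hurwitzZetaFn s (a + K)) (lerchFn (a + K)) 0 := by
    rw [lerchFn, sDeriv, iteratedDeriv_one]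
    exact (analyticAt_hurwitzZetaFn_of_re_pos zero_ne_one
      h.re_pos).hasDerivAt_fst.differentiableAt.hasDerivAt
  have h5 := (HasDerivAt.fun_sum h1).fun_add h3
  have h6 : sDeriv (logSum K ℓ) 1 0 a = ∑ n ∈ Finset.range K, -ℓ n a + lerchFn (a + K) := by
    rw [sDeriv, iteratedDeriv_one]
    exact h5.deriv
  have h7 : ∀ n ∈ Finset.range K, Complex.exp (-ℓ n a) = ((n : ℂ) + a)⁻¹ := fun n hn => by
    rw [Complex.exp_neg, (h.exp_eq n (Finset.mem_range.1 hn)).self_of_nhds]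
  have h8 : (∏ n ∈ Finset.range K, ((n : ℂ) + a)) ≠ 0 :=
    Finset.prod_ne_zero_iff.2 fun n _ => natCast_add_ne_zero h.not_mem n
  rw [h6, Complex.exp_add, Complex.exp_sum, Finset.prod_congr rfl h7, Finset.prod_inv_distrib,
    exp_lerchFn h.re_pos, Gamma_add_natCast h.not_mem]
  field_simp

theorem IsLogSystemAt.tendsto_sub_one_mul_logSum (h : IsLogSystemAt K ℓ a) :
    Tendsto (fun s => (s - 1) * logSum K ℓ s a) (𝓝[≠] 1) (𝓝 1) := by
  have h1 : Differentiable ℂ fun s : ℂ => ∑ n ∈ Finset.range K, Complex.exp (-(s * ℓ n a)) := by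
    fun_prop
  have h2 := (tendsto_sub_one_mul_of_continuousAt (h1 1).continuousAt).add
    (tendsto_sub_one_mul_hurwitzZetaFn_of_re_pos h.re_pos)
  rw [zero_add] at h2
  refine h2.congr fun s => ?_
  rw [logSum]
  ring

/-- Near `a`, the function `Z` is given by a system of logarithms. -/
structure HasLogForm (Z : ℂ → ℂ → ℂ) (K : ℕ) (ℓ : ℕ → ℂ → ℂ) (a : ℂ) : Prop where
  isLogSystemAt : IsLogSystemAt K ℓ a
  eventually_eq : ∀ s : ℂ, s ≠ 1 → ∀ᶠ z : ℂ × ℂ in 𝓝 (s, a), Z z.1 z.2 = logSum K ℓ z.1 z.2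

theorem IsLogSystemAt.hasLogForm (h : IsLogSystemAt K ℓ a) : HasLogForm (logSum K ℓ) K ℓ a :=
  ⟨h, fun _ _ => Eventually.of_forall fun _ => rfl⟩

namespace HasLogForm

variable {Z : ℂ → ℂ → ℂ}

theorem eq_logSum (h : HasLogForm Z K ℓ a) {s : ℂ} (hs : s ≠ 1) : Z s a = logSum K ℓ s a :=
  (h.eventually_eq s hs).self_of_nhds

theorem analyticAt (h : HasLogForm Z K ℓ a) {s : ℂ} (hs : s ≠ 1) :
    AnalyticAt ℂ (fun z : ℂ × ℂ => Z z.1 z.2) (s, a) :=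
  (h.isLogSystemAt.analyticAt_logSum hs).congr ((h.eventually_eq s hs).mono fun _ h => h.symm)

theorem hasDerivAt (h : HasLogForm Z K ℓ a) {s : ℂ} (hs : s ≠ 1) :
    HasDerivAt (fun b => Z s b) (-(if s = 0 then 1 else s * Z (s + 1) a)) a := by
  have hc : ContinuousAt (fun b : ℂ => (s, b)) a := by fun_prop
  have h1 := (h.isLogSystemAt.hasDerivAt_logSum hs).congr_of_eventuallyEq
    (hc.eventually (h.eventually_eq s hs))
  refine h1.congr_deriv ?_
  split_ifs with h0
  · rfl
  · rw [h.eq_logSum (by simpa using h0)]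

theorem iteratedDeriv_deriv (h : HasLogForm Z K ℓ a) (r : ℕ) :
    iteratedDeriv r (fun w => deriv (fun b => Z w b) a) 0 =
      -(r.factorial : ℂ) * laurentGamma Z ((r : ℤ) - 1) a := by
  have h1 : (fun w => deriv (fun b => Z w b) a) =ᶠ[𝓝 0]
      fun w => -(if w = 0 then 1 else w * Z (w + 1) a) := by
    filter_upwards [isOpen_compl_singleton.mem_nhds
      (show (0 : ℂ) ∈ ({1}ᶜ : Set ℂ) by simp)] with w hw
    exact (h.hasDerivAt hw).deriv
  have hf : (r.factorial : ℂ) ≠ 0 := by exact_mod_cast r.factorial_ne_zero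
  rw [h1.iteratedDeriv_eq, laurentGamma_natCast_sub_one, iteratedDeriv_fun_neg]
  field_simp

theorem hasDerivAt_sDeriv (h : HasLogForm Z K ℓ a) (r : ℕ) :
    HasDerivAt (fun b => sDeriv Z r 0 b)
      (-(r.factorial : ℂ) * laurentGamma Z ((r : ℤ) - 1) a) a := by
  have h1 := (analyticAt_sDeriv_snd (h.analyticAt zero_ne_one) r).differentiableAt.hasDerivAt
  refine h1.congr_deriv ?_
  have h2 := iteratedDeriv_comm (h.analyticAt zero_ne_one) 1 r
  simp only [iteratedDeriv_one] at h2
  exact h2.trans (h.iteratedDeriv_deriv r)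

theorem sDeriv_eq (h : HasLogForm Z K ℓ a) (r : ℕ) {s : ℂ} (hs : s ≠ 1) :
    sDeriv Z r s a = sDeriv (logSum K ℓ) r s a := by
  have h1 : (fun w => Z w a) =ᶠ[𝓝 s] fun w => logSum K ℓ w a := by
    filter_upwards [isOpen_compl_singleton.mem_nhds hs] with w hw
    exact h.eq_logSum hw
  exact h1.iteratedDeriv_eq r

theorem exp_sDeriv (h : HasLogForm Z K ℓ a) : Complex.exp (sDeriv Z 1 0 a) =
    Complex.Gamma a / (Real.sqrt (2 * Real.pi) : ℂ) := by
  rw [h.sDeriv_eq 1 zero_ne_one, h.isLogSystemAt.exp_sDeriv]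

/-- This is the logarithmic derivative of Lerch's formula. It is taken for `logSum`, for which the
formula is available at all points near `a`. -/
theorem digamma_eq (h : HasLogForm Z K ℓ a) : Complex.digamma a = -laurentGamma Z 0 a := by
  have h0 := h.isLogSystemAt
  have h1 := (h0.hasLogForm.hasDerivAt_sDeriv 1).cexp
  have hp : (Real.sqrt (2 * Real.pi) : ℂ) ≠ 0 := by
    have : 0 < Real.sqrt (2 * Real.pi) := Real.sqrt_pos.2 (by positivity)
    exact_mod_cast this.ne'
  have h2 : HasDerivAt (fun b => Complex.Gamma b / (Real.sqrt (2 * Real.pi) : ℂ)) _ a :=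
    h1.congr_of_eventuallyEq (h0.eventually.mono fun b hb => hb.exp_sDeriv.symm)
  have hG : DifferentiableAt ℂ Complex.Gamma a :=
    Complex.differentiableAt_Gamma a fun m hm => h0.not_mem ⟨m, hm⟩
  have h3 := h2.unique (hG.hasDerivAt.div_const _)
  have hG0 : Complex.Gamma a ≠ 0 := Complex.Gamma_ne_zero fun m hm => h0.not_mem ⟨m, hm⟩
  rw [h0.exp_sDeriv] at h3
  rw [laurentGamma_congr (W := logSum K ℓ) (fun s hs => h.eq_logSum hs), Complex.digamma_def,
    logDeriv_apply]
  simp only [Nat.factorial_one, Nat.cast_one, sub_self] at h3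
  field_simp at h3
  field_simp
  linear_combination -h3

theorem differentiableOn (h : HasLogForm Z K ℓ a) : DifferentiableOn ℂ (fun s => Z s a) {1}ᶜ :=
  fun _ hs => (h.analyticAt hs).hasDerivAt_fst.differentiableAt.differentiableWithinAt

theorem tendsto_sub_one_mul (h : HasLogForm Z K ℓ a) :
    Tendsto (fun s => (s - 1) * Z s a) (𝓝[≠] 1) (𝓝 1) := by
  refine h.isLogSystemAt.tendsto_sub_one_mul_logSum.congr' ?_
  filter_upwards [self_mem_nhdsWithin] with s hs
  rw [h.eq_logSum hs]

end HasLogForm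

/-- Pointwise in `a`, the principal determination comes from a system of logarithms. -/
theorem exists_isLogSystemAt_hurwitzZetaFn (ha : a ∉ nonposIntegers) :
    ∃ K ℓ, IsLogSystemAt K ℓ a ∧ ∀ s, s ≠ 1 → hurwitzZetaFn s a = logSum K ℓ s a := by
  obtain ⟨K, hK⟩ := exists_re_add_natCast_pos a
  -- The analytic logarithms are normalised to the principal values at `a`. If `a` lies on the cut,
  -- the principal powers can jump nearby, so only values at `a` itself are compared.
  refine ⟨K, _, isLogSystemAt_logNear ha hK (fun n => Complex.log (n + a))
    (fun n => Complex.exp_log (natCast_add_ne_zero ha n)), fun s hs => ?_⟩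
  rw [hurwitzZetaFn_eq_sum_add ha hK hs, logSum]
  congr 1
  refine Finset.sum_congr rfl fun n _ => ?_
  have hn := natCast_add_ne_zero ha n
  rw [logNear_self hn, Complex.cpow_def_of_ne_zero hn]
  ring_nf

theorem digamma_eq_neg_laurentGamma (ha : a ∉ nonposIntegers) :
    Complex.digamma a = -laurentGamma hurwitzZetaFn 0 a := by
  obtain ⟨K, ℓ, h1, h2⟩ := exists_isLogSystemAt_hurwitzZetaFn ha
  rw [laurentGamma_congr h2, h1.hasLogForm.digamma_eq]

theorem hasLogForm_hurwitzZetaFn_of_re_pos (ha : 0 < a.re) :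
    HasLogForm hurwitzZetaFn 0 (fun _ => id) a :=
  ⟨⟨by simpa using ha, fun _ h => absurd h (Nat.not_lt_zero _),
    fun _ h => absurd h (Nat.not_lt_zero _)⟩,
    fun s _ => Eventually.of_forall fun z => by simp [logSum]⟩

end LogSystem

/-! ### Continuation along paths: existence, uniqueness, and the form of all branches. -/

section PathContinuation

variable {K : ℕ} {ℓ ℓ' : ℕ → ℂ → ℂ} {a : ℂ}

theorem IsLogSystemAt.eventuallyEq (h : IsLogSystemAt K ℓ a) (h' : IsLogSystemAt K ℓ' a)
    (heq : ∀ n < K, ℓ n a = ℓ' n a) (s : ℂ) :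
    ∀ᶠ z : ℂ × ℂ in 𝓝 (s, a), logSum K ℓ z.1 z.2 = logSum K ℓ' z.1 z.2 := by
  have h1 : ∀ᶠ b in 𝓝 a, ∀ n ∈ Finset.range K, ℓ n b = ℓ' n b := by
    refine (eventually_all_finset _).2 fun n hn => ?_
    have hn' := Finset.mem_range.1 hn
    refine eventuallyEq_of_exp_eq (h.analyticAt n hn').continuousAt
      (h'.analyticAt n hn').continuousAt ?_ (heq n hn')
    filter_upwards [h.exp_eq n hn', h'.exp_eq n hn'] with b hb hb'
    rw [hb, hb']
  have h2 : ∀ᶠ z : ℂ × ℂ in 𝓝 (s, a), ∀ n ∈ Finset.range K, ℓ n z.2 = ℓ' n z.2 := by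
    have hc : ContinuousAt (fun z : ℂ × ℂ => z.2) (s, a) := continuousAt_snd
    exact hc.eventually h1
  filter_upwards [h2] with z hz
  rw [logSum, logSum]
  congr 1
  exact Finset.sum_congr rfl fun n hn => by rw [hz n hn]

theorem isLogSystemAt_log (ha : a ∈ Complex.slitPlane) (hK : 0 < (a + K).re) :
    IsLogSystemAt K (fun n b => Complex.log (n + b)) a := by
  have hn : ∀ n : ℕ, (n : ℂ) + a ∈ Complex.slitPlane := by
    intro n
    rcases ha with h | h
    · exact natCast_add_mem_slitPlane h n
    · exact Or.inr (by simpa using h)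
  refine ⟨hK, fun n _ => AnalyticAt.clog (by fun_prop) (hn n), fun n _ => ?_⟩
  have h1 : ∀ᶠ b : ℂ in 𝓝 a, (n : ℂ) + b ≠ 0 :=
    ContinuousAt.eventually_ne (by fun_prop) (Complex.slitPlane_ne_zero (hn n))
  filter_upwards [h1] with b hb
  exact Complex.exp_log hb

theorem hasLogForm_hurwitzZetaFn (ha : a ∈ Complex.slitPlane) (hK : 0 < (a + K).re) :
    HasLogForm hurwitzZetaFn K (fun n b => Complex.log (n + b)) a := by
  refine ⟨isLogSystemAt_log ha hK, fun s hs => ?_⟩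
  have h1 : ∀ᶠ z : ℂ × ℂ in 𝓝 (s, a), z.1 ≠ 1 := continuousAt_fst.eventually_ne hs
  have h2 : ∀ᶠ z : ℂ × ℂ in 𝓝 (s, a), z.2 ∈ Complex.slitPlane :=
    continuousAt_snd.eventually_mem (Complex.isOpen_slitPlane.mem_nhds ha)
  have h3 : ∀ᶠ z : ℂ × ℂ in 𝓝 (s, a), 0 < (z.2 + K).re :=
    continuousAt_const.eventually_lt (by fun_prop) hK
  filter_upwards [h1, h2, h3] with z hz1 hz2 hz3
  have hz := not_mem_nonposIntegers_of_mem_slitPlane hz2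
  rw [hurwitzZetaFn_eq_sum_add hz hz3 hz1, logSum]
  congr 1
  refine Finset.sum_congr rfl fun n _ => ?_
  rw [Complex.cpow_def_of_ne_zero (natCast_add_ne_zero hz n)]
  ring_nf

theorem analyticAt_hurwitzZetaFn {s : ℂ} (hs : s ≠ 1) (ha : a ∈ Complex.slitPlane) :
    AnalyticAt ℂ (fun z : ℂ × ℂ => hurwitzZetaFn z.1 z.2) (s, a) := by
  obtain ⟨K, hK⟩ := exists_re_add_natCast_pos a
  exact (hasLogForm_hurwitzZetaFn ha hK).analyticAt hs

theorem isHurwitzBranchAt_hurwitzZetaFn (ha : a ∈ Complex.slitPlane) :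
    IsHurwitzBranchAt hurwitzZetaFn a := by
  have h1 : IsPathConnected Complex.slitPlane :=
    Complex.starConvex_one_slitPlane.isPathConnected Complex.one_mem_slitPlane
  have h2 : JoinedIn Complex.slitPlane 1 a := h1.joinedIn 1 Complex.one_mem_slitPlane a ha
  exact ⟨h2.somePath, fun t => not_mem_nonposIntegers_of_mem_slitPlane (h2.somePath_mem t),
    fun _ => hurwitzZetaFn, ⟨fun t s hs => analyticAt_hurwitzZetaFn hs (h2.somePath_mem t),
      fun s _ => Eventually.of_forall fun _ => rfl,
      fun t => Eventually.of_forall fun t' s _ => Eventually.of_forall fun _ => rfl⟩,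
    fun s _ => Eventually.of_forall fun _ => rfl⟩

variable {α₀ : ℂ} {p : Path (1 : ℂ) α₀}

/-- The path `n + p t` avoids `0`, so it lifts through the covering map `exp`, starting from the
principal logarithm. -/
theorem exists_log_lift (hp : ∀ t, p t ∉ nonposIntegers) (n : ℕ) :
    ∃ c : unitInterval → ℂ, Continuous c ∧ (∀ t, Complex.exp (c t) = n + p t) ∧
      c 0 = Complex.log (n + 1) := by
  let γ : C(unitInterval, {z : ℂ // z ≠ 0}) :=
    ⟨fun t => ⟨(n : ℂ) + p t, natCast_add_ne_zero (hp t) n⟩, by fun_prop⟩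
  obtain ⟨Γ, h1, h2⟩ := Complex.isCoveringMap_exp.exists_path_lifts γ (Complex.log (n + 1))
    (Subtype.ext (by
      change (n : ℂ) + p 0 = Complex.exp (Complex.log (n + 1))
      rw [Complex.exp_log (Nat.cast_add_one_ne_zero n), p.source]))
  exact ⟨Γ, Γ.continuous, fun t => congrArg Subtype.val (congrFun h1 t), h2⟩

theorem exists_forall_re_add_natCast_pos (p : Path (1 : ℂ) α₀) :
    ∃ K₀ : ℕ, ∀ K ≥ K₀, ∀ t, 0 < (p t + K).re := by
  obtain ⟨C, hC⟩ := (isCompact_univ (X := unitInterval)).exists_bound_of_continuousOn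
    p.continuous.continuousOn
  obtain ⟨K₀, hK₀⟩ := exists_nat_gt C
  refine ⟨K₀, fun K hK t => ?_⟩
  have h1 := (abs_le.1 ((Complex.abs_re_le_norm (p t)).trans (hC t (Set.mem_univ t)))).1
  have h2 : (K₀ : ℝ) ≤ K := by exact_mod_cast hK
  simp only [Complex.add_re, Complex.natCast_re]
  linarith

/-- Along every path avoiding the non-positive integers, `ζ` is continued by systems of
logarithms. -/
theorem exists_isContinuationAlong (hp : ∀ t, p t ∉ nonposIntegers) :
    ∃ K₀ : ℕ, ∀ K ≥ K₀, ∃ ℓ : unitInterval → ℕ → ℂ → ℂ, (∀ t, IsLogSystemAt K (ℓ t) (p t)) ∧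
      IsContinuationAlong p fun t => logSum K (ℓ t) := by
  obtain ⟨K₀, hK₀⟩ := exists_forall_re_add_natCast_pos p
  choose c hc hexp h0 using exists_log_lift hp
  refine ⟨K₀, fun K hK => ⟨fun t n b => logNear ((n : ℂ) + p t) (c n t) (n + b), ?_⟩⟩
  have hsys : ∀ t, IsLogSystemAt K (fun n b => logNear ((n : ℂ) + p t) (c n t) (n + b)) (p t) :=
    fun t => isLogSystemAt_logNear (hp t) (hK₀ K hK t) (fun n => c n t) fun n => hexp n t
  refine ⟨hsys, fun t s hs => (hsys t).analyticAt_logSum hs, fun s hs => ?_, fun t => ?_⟩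
  · have h1 : 0 < ((1 : ℂ) + K).re := by simpa using hK₀ K hK 0
    have h2 := hasLogForm_hurwitzZetaFn Complex.one_mem_slitPlane h1
    have h3 := hsys 0
    rw [p.source] at h3
    have h4 := h3.eventuallyEq h2.isLogSystemAt (fun n _ => by
      rw [logNear_self (Nat.cast_add_one_ne_zero n), h0]) s
    simp only [p.source]
    filter_upwards [h4, h2.eventually_eq s hs] with z hz hz'
    rw [hz, hz']
  -- By continuity of the lift, the logarithm constructed at `p t` takes the lifted value at `p t'`;
  -- hence the systems of `t` and `t'` have the same germ there.
  · have h1 : ∀ᶠ t' in 𝓝 t, ∀ n ∈ Finset.range K,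
        c n t' = logNear ((n : ℂ) + p t) (c n t) (n + p t') := by
      refine (eventually_all_finset _).2 fun n hn => ?_
      have hg : ContinuousAt (fun t' => logNear ((n : ℂ) + p t) (c n t) (n + p t')) t :=
        ContinuousAt.comp (g := fun b => logNear ((n : ℂ) + p t) (c n t) (n + b))
          ((hsys t).analyticAt n (Finset.mem_range.1 hn)).continuousAt p.continuous.continuousAt
      refine eventuallyEq_of_exp_eq (hc n).continuousAt hg (Eventually.of_forall fun t' => ?_) ?_
      · rw [hexp, exp_logNear (hexp n t) (natCast_add_ne_zero (hp t') n)]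
      · rw [logNear_self (natCast_add_ne_zero (hp t) n)]
    filter_upwards [h1, p.continuous.continuousAt.eventually (hsys t).eventually] with t' ht' ht2
    intro s _
    refine (hsys t').eventuallyEq ht2 (fun n hn => ?_) s
    rw [logNear_self (natCast_add_ne_zero (hp t') n)]
    exact ht' n (Finset.mem_range.2 hn)

theorem isPreconnected_compl_one_prod {V : Set ℂ} (hV : IsPreconnected V) :
    IsPreconnected (({1}ᶜ : Set ℂ) ×ˢ V) :=
  (isConnected_compl_singleton_of_one_lt_rank (by simp) 1).isPreconnected.prod hV

/-- Analytic continuation along a path is unique. -/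
theorem IsContinuationAlong.eventuallyEq {F G : unitInterval → ℂ → ℂ → ℂ}
    (hF : IsContinuationAlong p F) (hG : IsContinuationAlong p G) (t : unitInterval) {s : ℂ}
    (hs : s ≠ 1) : ∀ᶠ z : ℂ × ℂ in 𝓝 (s, p t), F t z.1 z.2 = G t z.1 z.2 := by
  -- Equality of germs is tested at `s = 0` only and shown to be locally constant in `t`.
  -- Connectedness of `ℂ ∖ {1}` spreads it to every `s` at the end.
  let P : unitInterval → Prop := fun t =>
    ∀ᶠ z : ℂ × ℂ in 𝓝 (0, p t), F t z.1 z.2 = G t z.1 z.2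
  have hP : IsLocallyConstant P := by
    refine (IsLocallyConstant.iff_eventually_eq P).2 fun t => ?_
    have hc : ContinuousAt (fun t' => ((0 : ℂ), p t')) t := by fun_prop
    have h1 := hc.eventually ((hF.1 t 0 zero_ne_one).eventually_eventuallyEq_imp
      (hG.1 t 0 zero_ne_one))
    have h2 : ∀ᶠ t' in 𝓝 t, P t → ∀ᶠ z : ℂ × ℂ in 𝓝 (0, p t'), F t z.1 z.2 = G t z.1 z.2 := by
      by_cases ht : P t
      · filter_upwards [hc.eventually (eventually_eventually_nhds.2 ht)] with t' ht' _
        exact ht'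
      · exact Eventually.of_forall fun t' h => absurd h ht
    filter_upwards [h1, h2, hF.2.2 t, hG.2.2 t] with t' h1' h2' hF' hG'
    refine propext ⟨fun h => h1' ?_, fun h => ?_⟩
    · filter_upwards [h, hF' 0 zero_ne_one, hG' 0 zero_ne_one] with z hz hz1 hz2
      rw [← hz1, ← hz2, hz]
    · filter_upwards [h2' h, hF' 0 zero_ne_one, hG' 0 zero_ne_one] with z hz hz1 hz2
      rw [hz1, hz2, hz]
  have h0 : P 0 := by
    change ∀ᶠ z : ℂ × ℂ in 𝓝 (0, p 0), F 0 z.1 z.2 = G 0 z.1 z.2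
    rw [p.source]
    filter_upwards [hF.2.1 0 zero_ne_one, hG.2.1 0 zero_ne_one] with z hz1 hz2
    rw [hz1, hz2]
  have ht : P t := by rw [hP.apply_eq_of_preconnectedSpace t 0]; exact h0
  exact AnalyticOnNhd.eventuallyEq_of_preconnected (U := ({1}ᶜ : Set ℂ) ×ˢ {p t})
    (f := fun z => F t z.1 z.2) (g := fun z => G t z.1 z.2)
    (by rintro ⟨w, b⟩ ⟨hw, rfl⟩; exact hF.1 t w hw)
    (by rintro ⟨w, b⟩ ⟨hw, rfl⟩; exact hG.1 t w hw)
    (isPreconnected_compl_one_prod isPreconnected_singleton)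
    (x := (0, p t)) ⟨by simp, rfl⟩ ht (y := (s, p t)) ⟨hs, rfl⟩

/-- Uniqueness identifies the given continuation with the one by lifted logarithms. All large `K`
are allowed, so that `K` can later be adapted to a boundary point. -/
theorem IsHurwitzBranchAt.exists_hasLogForm {Z : ℂ → ℂ → ℂ} (hZ : IsHurwitzBranchAt Z α₀) :
    ∃ K₀ : ℕ, ∀ K ≥ K₀, ∃ ℓ, HasLogForm Z K ℓ α₀ := by
  obtain ⟨p, hp, F, hF, hZF⟩ := hZ
  obtain ⟨K₀, h⟩ := exists_isContinuationAlong hp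
  refine ⟨K₀, fun K hK => ?_⟩
  obtain ⟨ℓ, h1, h2⟩ := h K hK
  have h3 := h1 1
  rw [p.target] at h3
  refine ⟨ℓ 1, h3, fun s hs => ?_⟩
  have h4 := hF.eventuallyEq h2 1 hs
  rw [p.target] at h4
  filter_upwards [hZF s hs, h4] with z hz1 hz2
  rw [hz1, hz2]

end PathContinuation

/-! ### Derivatives in `s` of a logarithmic sum. -/

section SDeriv

theorem sDeriv_logSum {K : ℕ} {ℓ : ℕ → ℂ → ℂ} {s a : ℂ} (hs : s ≠ 1) (hK : 0 < (a + K).re)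
    (r : ℕ) : sDeriv (logSum K ℓ) r s a =
      ∑ n ∈ Finset.range K, Complex.exp (-(s * ℓ n a)) * (-ℓ n a) ^ r +
        sDeriv hurwitzZetaFn r s (a + K) := by
  have h1 : ContDiffAt ℂ r (fun w => hurwitzZetaFn w (a + K)) s :=
    ((isHurwitzContinuation_of_re_pos hK).1.analyticAt
      (isOpen_compl_singleton.mem_nhds hs)).contDiffAt
  have h2 : ∀ n ∈ Finset.range K, ContDiffAt ℂ r (fun w => Complex.exp (-(w * ℓ n a))) s :=
    fun n _ => by fun_prop
  have h3 : sDeriv (logSum K ℓ) r s a = iteratedDeriv r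
      ((fun w => ∑ n ∈ Finset.range K, Complex.exp (-(w * ℓ n a))) +
        fun w => hurwitzZetaFn w (a + K)) s := rfl
  rw [h3, iteratedDeriv_add (ContDiffAt.sum h2) h1, iteratedDeriv_fun_sum h2]
  congr 1
  refine Finset.sum_congr rfl fun n _ => ?_
  have h4 : (fun w => Complex.exp (-(w * ℓ n a))) = fun w => Complex.exp (-ℓ n a * w) := by
    ext w; ring_nf
  rw [h4, iteratedDeriv_cexp_const_mul]
  ring_nf

end SDeriv

/-! ### Continuous extension to the boundary for `Re s < 0`. -/

section Boundary

/-- Hahn–Banach separates `w` from `V`; multiplication by `c` turns the separating half-plane into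
the right one, where the principal logarithm is analytic. -/
theorem exists_forall_re_mul_sub_pos {V : Set ℂ} (hV : IsOpen V) (hc : Convex ℝ V) {w : ℂ}
    (hw : w ∉ V) : ∃ c : ℂ, ∀ b ∈ V, 0 < (c * (b - w)).re := by
  obtain ⟨f, hf⟩ := RCLike.geometric_hahn_banach_open_point (𝕜 := ℂ) hc hV hw
  have h1 : ∀ b : ℂ, f b = f 1 * b := by
    intro b
    have := f.map_smul b 1
    rw [smul_eq_mul, mul_one, smul_eq_mul] at this
    rw [this, mul_comm]
  refine ⟨-f 1, fun b hb => ?_⟩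
  have h2 := hf b hb
  rw [h1 b, h1 w] at h2
  have h3 : -f 1 * (b - w) = f 1 * w - f 1 * b := by ring
  rw [h3, Complex.sub_re]
  exact sub_pos.2 h2

theorem tendsto_exp_neg_mul_pow {l : Filter ℂ} {L : ℂ → ℂ} {B : ℝ} {s : ℂ} (hs : s.re < 0) (r : ℕ)
    (him : ∀ᶠ b in l, |(L b).im| ≤ B) (hre : Tendsto (fun b => (L b).re) l atBot) :
    Tendsto (fun b => Complex.exp (-(s * L b)) * (-L b) ^ r) l (𝓝 0) := by
  -- The summands absorb, in turn, the shift by `|B|` in `u = -Re L + |B|` and the term `s.im * (L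
  -- b).im`. What remains is `u ^ r / exp (-s.re * u)`, with `u → ∞` and `-s.re > 0`.
  set C : ℝ := |s.re| * |B| + |s.im| * |B| with hC
  have h1 : Tendsto (fun u : ℝ => Real.exp C * (u ^ r / Real.exp (-s.re * u))) atTop (𝓝 0) := by
    have := (isLittleO_pow_exp_pos_mul_atTop (k := r) (b := -s.re) (by linarith)).tendsto_div_nhds_zero
    simpa using this.const_mul (Real.exp C)
  have h2 : Tendsto (fun b => -(L b).re + |B|) l atTop :=
    tendsto_atTop_add_const_right _ _ (tendsto_neg_atBot_atTop.comp hre)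
  refine squeeze_zero_norm' ?_ (h1.comp h2)
  filter_upwards [him, hre.eventually_le_atBot 0] with b hb1 hb2
  have hB : |(L b).im| ≤ |B| := hb1.trans (le_abs_self B)
  set u : ℝ := -(L b).re + |B| with hu
  have hnorm : ‖-L b‖ ≤ u := by
    rw [norm_neg]
    refine (Complex.norm_le_abs_re_add_abs_im _).trans ?_
    rw [abs_of_nonpos hb2]
    linarith
  have hexp : ‖Complex.exp (-(s * L b))‖ ≤ Real.exp C * (Real.exp (-s.re * u))⁻¹ := by
    rw [← Real.exp_neg, ← Real.exp_add, Complex.norm_exp]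
    refine Real.exp_le_exp.2 ?_
    have h3 : s.im * (L b).im ≤ |s.im| * |B| :=
      (le_abs_self _).trans (by rw [abs_mul]; gcongr)
    have h4 : (-(s * L b)).re = -(s.re * (L b).re) + s.im * (L b).im := by
      rw [Complex.neg_re, Complex.mul_re]
      ring
    rw [h4, hC, hu, abs_of_neg hs]
    nlinarith
  change ‖_‖ ≤ Real.exp C * (u ^ r / Real.exp (-s.re * u))
  rw [norm_mul, norm_pow]
  calc _ ≤ Real.exp C * (Real.exp (-s.re * u))⁻¹ * u ^ r := by gcongr
    _ = _ := by ring

/-- A single formula gives logarithms on all of `V` with imaginary parts bounded on `V`; the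
constants `d n` adjust them to prescribed values at `a`. -/
theorem exists_isLogSystemAt_of_convex {V : Set ℂ} (hV : IsOpen V) (hc : Convex ℝ V)
    (hN : ∀ b ∈ V, b ∉ nonposIntegers) {a : ℂ} (ha : a ∈ V) {K : ℕ}
    (hK : ∀ b ∈ V, 0 < (b + K).re) (e : ℕ → ℂ) (he : ∀ n < K, Complex.exp (e n) = n + a) :
    ∃ c : ℕ → ℂ, (∀ n : ℕ, ∀ b ∈ V, 0 < (c n * (b + n)).re) ∧
      ∃ d : ℕ → ℂ, (∀ b ∈ V, IsLogSystemAt K (fun n b => Complex.log (c n * (b + n)) + d n) b) ∧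
        ∀ n, Complex.log (c n * (a + n)) + d n = e n := by
  have h1 : ∀ n : ℕ, ∃ c : ℂ, ∀ b ∈ V, 0 < (c * (b + n)).re := by
    intro n
    obtain ⟨c, hc'⟩ := exists_forall_re_mul_sub_pos hV hc (w := -(n : ℂ))
      fun h => hN _ h ⟨n, rfl⟩
    exact ⟨c, fun b hb => by simpa using hc' b hb⟩
  choose c hc' using h1
  have hne : ∀ n : ℕ, ∀ b ∈ V, c n * (b + n) ≠ 0 := fun n b hb h => by
    have := hc' n b hb
    rw [h] at this
    simp at this
  refine ⟨c, hc', fun n => e n - Complex.log (c n * (a + n)), fun b hb =>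
    ⟨hK b hb, fun n _ => ?_, fun n hn => ?_⟩, fun n => by ring⟩
  · have h2 : AnalyticAt ℂ (fun b : ℂ => c n * (b + n)) b := by fun_prop
    exact (h2.clog (Or.inl (hc' n b hb))).add analyticAt_const
  · filter_upwards [hV.mem_nhds hb] with x hx
    rw [Complex.exp_add, Complex.exp_sub, Complex.exp_log (hne n x hx),
      Complex.exp_log (hne n a ha), he n hn]
    have h1 := hne n a ha
    have h2 : c n ≠ 0 := left_ne_zero_of_mul h1
    have h3 : a + n ≠ 0 := right_ne_zero_of_mul h1
    field_simp
    ring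

theorem HasLogForm.of_isPreconnected {Z : ℂ → ℂ → ℂ} {V : Set ℂ} (hV : IsPreconnected V) {K : ℕ}
    {ℓ : ℕ → ℂ → ℂ} (hZ : ∀ b ∈ V, ∀ s, s ≠ 1 → AnalyticAt ℂ (fun z : ℂ × ℂ => Z z.1 z.2) (s, b))
    (hℓ : ∀ b ∈ V, IsLogSystemAt K ℓ b) {a : ℂ} (ha : a ∈ V) (h : HasLogForm Z K ℓ a) {b : ℂ}
    (hb : b ∈ V) : HasLogForm Z K ℓ b := by
  refine ⟨hℓ b hb, fun s hs => ?_⟩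
  have hf : AnalyticOnNhd ℂ (fun z : ℂ × ℂ => Z z.1 z.2) (({1}ᶜ : Set ℂ) ×ˢ V) :=
    fun z hz => hZ z.2 hz.2 z.1 hz.1
  have hg : AnalyticOnNhd ℂ (fun z : ℂ × ℂ => logSum K ℓ z.1 z.2) (({1}ᶜ : Set ℂ) ×ˢ V) :=
    fun z hz => (hℓ z.2 hz.2).analyticAt_logSum hz.1
  have h0 : ((0 : ℂ), a) ∈ ({1}ᶜ : Set ℂ) ×ˢ V := ⟨by simp, ha⟩
  have hs' : (s, b) ∈ ({1}ᶜ : Set ℂ) ×ˢ V := ⟨hs, hb⟩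
  exact hf.eventuallyEq_of_preconnected hg (isPreconnected_compl_one_prod hV) h0
    (h.eventually_eq 0 zero_ne_one) hs'

theorem IsHurwitzBranchAt.exists_tendsto_sDeriv {Z : ℂ → ℂ → ℂ} {U : Set ℂ} (hU : IsOpen U)
    (hc : Convex ℝ U) (hZ : ∀ b ∈ U, IsHurwitzBranchAt Z b) (r : ℕ) {s : ℂ} (hs : s.re < 0)
    {β : ℂ} (hβ : β ∈ closure U) : ∃ y, Tendsto (fun b => sDeriv Z r s b) (𝓝[U] β) (𝓝 y) := by
  have hs1 : s ≠ 1 := by rintro rfl; simp at hs; linarith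
  -- Boundedness of `V` allows one `K` for all its points and for `β`.
  set V := U ∩ Metric.ball β 1 with hVdef
  have hVo : IsOpen V := hU.inter Metric.isOpen_ball
  have hVc : Convex ℝ V := hc.inter (convex_ball β 1)
  obtain ⟨a, haV⟩ : V.Nonempty := by
    obtain ⟨a, ha1, ha2⟩ := Metric.mem_closure_iff.1 hβ 1 one_pos
    exact ⟨a, ha1, by rwa [Metric.mem_ball, dist_comm]⟩
  obtain ⟨K₀, hK₀⟩ := (hZ a haV.1).exists_hasLogForm
  obtain ⟨K₁, hK₁⟩ := exists_nat_gt (1 - β.re)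
  set K := max K₀ K₁
  have hKβ : 1 - β.re < K := hK₁.trans_le (by exact_mod_cast le_max_right K₀ K₁)
  obtain ⟨e, he⟩ := hK₀ K (le_max_left _ _)
  have hKV : ∀ b ∈ V, 0 < (b + K).re := by
    intro b hb
    have h1 := hb.2
    rw [Metric.mem_ball, dist_comm, dist_eq_norm] at h1
    have h2 := (Complex.re_le_norm _).trans_lt h1
    simp only [Complex.sub_re, Complex.add_re, Complex.natCast_re] at h2 ⊢
    linarith
  have hN : ∀ b ∈ V, b ∉ nonposIntegers := by
    intro b hb
    obtain ⟨K', hK'⟩ := (hZ b hb.1).exists_hasLogForm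
    obtain ⟨ℓ, hℓ⟩ := hK' K' le_rfl
    exact hℓ.isLogSystemAt.not_mem
  obtain ⟨c, hcV, d, hL, hLa⟩ := exists_isLogSystemAt_of_convex hVo hVc hN haV hKV
    (fun n => e n a) fun n hn => (he.isLogSystemAt.exp_eq n hn).self_of_nhds
  set L : ℕ → ℂ → ℂ := fun n b => Complex.log (c n * (b + n)) + d n with hLdef
  have hform : HasLogForm Z K L a := by
    refine ⟨hL a haV, fun w hw => ?_⟩
    filter_upwards [he.eventually_eq w hw,
      (hL a haV).eventuallyEq he.isLogSystemAt (fun n _ => hLa n) w] with z hz1 hz2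
    rw [hz1, hz2]
  have hval : ∀ b ∈ V, sDeriv Z r s b = ∑ n ∈ Finset.range K,
      Complex.exp (-(s * L n b)) * (-L n b) ^ r + sDeriv hurwitzZetaFn r s (b + K) := by
    intro b hb
    have h1 : HasLogForm Z K L b := hform.of_isPreconnected hVc.isPreconnected
      (fun x hx w hw => by
        obtain ⟨K', hK'⟩ := (hZ x hx.1).exists_hasLogForm
        obtain ⟨ℓ, hℓ⟩ := hK' K' le_rfl
        exact hℓ.analyticAt hw) hL haV hb
    rw [h1.sDeriv_eq r hs1, sDeriv_logSum hs1 (hKV b hb)]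
  have hnhds : 𝓝[U] β = 𝓝[V] β :=
    (nhdsWithin_inter_of_mem' (mem_nhdsWithin_of_mem_nhds (Metric.ball_mem_nhds β one_pos))).symm
  have hterm : ∀ n, ∃ y, Tendsto (fun b => Complex.exp (-(s * L n b)) * (-L n b) ^ r)
      (𝓝[V] β) (𝓝 y) := by
    intro n
    have hc0 : c n ≠ 0 := by
      intro h
      have := hcV n a haV
      rw [h] at this
      simp at this
    -- Only the term with `n = -β` is singular at `β`, and it tends to `0`.
    rcases eq_or_ne (β + n) 0 with h0 | h0
    · refine ⟨0, tendsto_exp_neg_mul_pow (B := Real.pi + |(d n).im|) hs r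
        (Eventually.of_forall fun b => ?_) ?_⟩
      · rw [hLdef]
        refine (abs_add_le _ _).trans (add_le_add_left ?_ _)
        rw [Complex.log_im]
        exact Complex.abs_arg_le_pi _
      · have h1 : Tendsto (fun b => ‖c n * (b + n)‖) (𝓝[V] β) (𝓝[>] 0) := by
          refine tendsto_nhdsWithin_iff.2 ⟨?_, ?_⟩
          · have h2 : ContinuousAt (fun b => ‖c n * (b + n)‖) β := by fun_prop
            have h3 := h2.tendsto
            rw [h0, mul_zero, norm_zero] at h3
            exact h3.mono_left nhdsWithin_le_nhds
          · filter_upwards [self_mem_nhdsWithin] with b hb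
            refine norm_pos_iff.2 fun h => ?_
            have := hcV n b hb
            rw [h] at this
            simp at this
        have h2 := tendsto_atBot_add_const_right _ (d n).re (Real.tendsto_log_nhdsGT_zero.comp h1)
        refine h2.congr fun b => ?_
        simp [hLdef, Complex.log_re]
    -- As a limit of points of the right half-plane, `c n * (β + n)` has real part `≥ 0`; being
    -- nonzero, it stays off the cut.
    · have hslit : c n * (β + n) ∈ Complex.slitPlane := by
        have hre : 0 ≤ (c n * (β + n)).re := by
          have hcl : β ∈ closure V := by
            rw [mem_closure_iff_nhdsWithin_neBot, ← hnhds]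
            exact mem_closure_iff_nhdsWithin_neBot.1 hβ
          have hclosed : IsClosed {b : ℂ | 0 ≤ (c n * (b + n)).re} :=
            isClosed_le continuous_const (by fun_prop)
          exact closure_minimal (fun b hb => (hcV n b hb).le) hclosed hcl
        have hne := mul_ne_zero hc0 h0
        rcases hre.lt_or_eq with h | h
        · exact Or.inl h
        · exact Or.inr fun h' => hne (Complex.ext h.symm h')
      have h1 : ContinuousAt (L n) β := by
        refine ContinuousAt.add (ContinuousAt.clog (by fun_prop) hslit) continuousAt_const
      have h2 : ContinuousAt (fun b => Complex.exp (-(s * L n b)) * (-L n b) ^ r) β :=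
        ((continuousAt_const.mul h1).neg.cexp).mul (h1.neg.pow r)
      exact ⟨_, h2.tendsto.mono_left nhdsWithin_le_nhds⟩
  choose y hy using hterm
  have hβK : 0 < (β + K).re := by
    simp only [Complex.add_re, Complex.natCast_re]
    linarith
  have hlast : ContinuousAt (fun b => sDeriv hurwitzZetaFn r s (b + K)) β := by
    refine ContinuousAt.comp (g := fun b => sDeriv hurwitzZetaFn r s b) (f := fun b => b + (K : ℂ))
      ?_ (by fun_prop)
    exact (analyticAt_sDeriv_snd (analyticAt_hurwitzZetaFn_of_re_pos hs1 hβK) r).continuousAt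
  rw [hnhds]
  refine ⟨∑ n ∈ Finset.range K, y n + sDeriv hurwitzZetaFn r s (β + K),
    Tendsto.congr' ?_ ((tendsto_finsetSum _ fun n _ => hy n).add
      (hlast.tendsto.mono_left nhdsWithin_le_nhds))⟩
  filter_upwards [self_mem_nhdsWithin] with b hb
  exact (hval b hb).symm

end Boundary

/-! ### Discreteness of the non-positive integers, and orders of poles. -/

section Poles

theorem isClosed_of_subset_nonposIntegers {S : Set ℂ} (hS : S ⊆ nonposIntegers) : IsClosed S := by
  have h : S = (fun n : ℤ => (n : ℂ)) '' ((fun n : ℤ => (n : ℂ)) ⁻¹' S) := by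
    rw [Set.image_preimage_eq_of_subset]
    intro z hz
    obtain ⟨n, rfl⟩ := hS hz
    exact ⟨-n, by simp⟩
  rw [h]
  exact Complex.isClosedEmbedding_intCast.isClosedMap _ (isClosed_discrete _)

theorem eventually_not_mem_nonposIntegers {a : ℂ} (ha : a ∉ nonposIntegers) :
    ∀ᶠ b in 𝓝 a, b ∉ nonposIntegers :=
  (isClosed_of_subset_nonposIntegers subset_rfl).isOpen_compl.mem_nhds ha

theorem eventually_not_mem_nonposIntegers_punctured (a : ℂ) :
    ∀ᶠ b in 𝓝[≠] a, b ∉ nonposIntegers := by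
  have h : (nonposIntegers \ {a})ᶜ ∈ 𝓝 a :=
    (isClosed_of_subset_nonposIntegers Set.sdiff_subset).isOpen_compl.mem_nhds fun h => h.2 rfl
  filter_upwards [mem_nhdsWithin_of_mem_nhds h, self_mem_nhdsWithin] with b hb hb' hbN
  exact hb ⟨hbN, hb'⟩

theorem meromorphicOrderAt_eq_neg_natCast {f g : ℂ → ℂ} {x c : ℂ} {m : ℕ} (hm : m ≠ 0) (hc : c ≠ 0)
    (hg : AnalyticAt ℂ g x) (h : ∀ᶠ z in 𝓝[≠] x, f z = c * ((z - x) ^ m)⁻¹ + g z) :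
    meromorphicOrderAt f x = (-(m : ℤ) : ℤ) := by
  have hpow : AnalyticAt ℂ (fun z => (z - x) ^ m) x := by fun_prop
  have hmer : MeromorphicAt (fun z => c * ((z - x) ^ m)⁻¹ + g z) x :=
    ((MeromorphicAt.const c x).mul hpow.meromorphicAt.inv).add hg.meromorphicAt
  have hf : MeromorphicAt f x := hmer.congr (h.mono fun z hz => hz.symm)
  rw [meromorphicOrderAt_eq_int_iff hf]
  refine ⟨fun z => c + (z - x) ^ m * g z, analyticAt_const.add (hpow.mul hg), ?_, ?_⟩
  · simpa [hm] using hc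
  · filter_upwards [h, self_mem_nhdsWithin] with z hz hz'
    have h1 : (z - x) ^ m ≠ 0 := pow_ne_zero _ (sub_ne_zero.2 hz')
    rw [hz, zpow_neg, zpow_natCast, smul_eq_mul]
    field_simp

end Poles

/-! ### Integer values of `s`. -/

section IntegerArguments

theorem cpow_neg_natCast (x : ℂ) (m : ℕ) : x ^ (-(m : ℂ)) = (x ^ m)⁻¹ := by
  rw [Complex.cpow_neg, Complex.cpow_natCast]

variable {a : ℂ} {m : ℕ}

theorem natCast_ne_one_of_two_le (hm : 2 ≤ m) : (m : ℂ) ≠ 1 := by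
  have : m ≠ 1 := by omega
  exact_mod_cast this

theorem hurwitzZetaFn_natCast_eq_sum_add (ha : a ∉ nonposIntegers) {K : ℕ} (hK : 0 < (a + K).re)
    (hm : 2 ≤ m) : hurwitzZetaFn m a =
      ∑ n ∈ Finset.range K, (((n : ℂ) + a) ^ m)⁻¹ + hurwitzZetaFn m (a + K) := by
  rw [hurwitzZetaFn_eq_sum_add ha hK (natCast_ne_one_of_two_le hm)]
  simp only [cpow_neg_natCast]

/-- At integer arguments all determinations agree. -/
theorem IsLogSystemAt.eventually_hurwitzZetaFn_natCast {K : ℕ} {ℓ : ℕ → ℂ → ℂ}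
    (h : IsLogSystemAt K ℓ a) (hm : 2 ≤ m) :
    ∀ᶠ b in 𝓝 a, hurwitzZetaFn m b = logSum K ℓ m b := by
  filter_upwards [h.eventually] with b hb
  rw [hurwitzZetaFn_natCast_eq_sum_add hb.not_mem hb.re_pos hm, logSum]
  congr 1
  refine Finset.sum_congr rfl fun n hn => ?_
  rw [Complex.exp_neg, Complex.exp_nat_mul,
    (hb.exp_eq n (Finset.mem_range.1 hn)).self_of_nhds]

theorem analyticAt_hurwitzZetaFn_natCast (hm : 2 ≤ m) (ha : a ∉ nonposIntegers) :
    AnalyticAt ℂ (fun b => hurwitzZetaFn m b) a := by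
  obtain ⟨K, ℓ, h, -⟩ := exists_isLogSystemAt_hurwitzZetaFn ha
  have h0 : AnalyticAt ℂ (fun b : ℂ => ((m : ℂ), b)) a := analyticAt_const.prod analyticAt_id
  have h1 : AnalyticAt ℂ (fun b => logSum K ℓ m b) a :=
    AnalyticAt.comp (g := fun z : ℂ × ℂ => logSum K ℓ z.1 z.2) (f := fun b : ℂ => ((m : ℂ), b))
      (h.analyticAt_logSum (natCast_ne_one_of_two_le hm)) h0
  exact h1.congr ((h.eventually_hurwitzZetaFn_natCast hm).mono fun b hb => hb.symm)

theorem hasDerivAt_hurwitzZetaFn_natCast (hm : 2 ≤ m) (ha : a ∉ nonposIntegers) :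
    HasDerivAt (fun b => hurwitzZetaFn m b) (-(m * hurwitzZetaFn (m + 1 : ℕ) a)) a := by
  obtain ⟨K, ℓ, h, -⟩ := exists_isLogSystemAt_hurwitzZetaFn ha
  have h1 := (h.hasDerivAt_logSum (natCast_ne_one_of_two_le hm)).congr_of_eventuallyEq
    (h.eventually_hurwitzZetaFn_natCast hm)
  have hm0 : (m : ℂ) ≠ 0 := by
    have : m ≠ 0 := by omega
    exact_mod_cast this
  have h2 := (h.eventually_hurwitzZetaFn_natCast (m := m + 1) (by omega)).self_of_nhds
  rw [if_neg hm0] at h1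
  rw [h2]
  push_cast
  exact h1

theorem neg_natCast_add_re_pos (N : ℕ) : 0 < (-(N : ℂ) + (N + 1 : ℕ)).re := by
  simp

theorem natCast_add_neg_ne_zero {n N : ℕ} (h : n < N) : (n : ℂ) + -(N : ℂ) ≠ 0 := by
  rw [← sub_eq_add_neg, sub_ne_zero]
  exact_mod_cast h.ne

theorem eventually_re_add_natCast_pos (N : ℕ) :
    ∀ᶠ b : ℂ in 𝓝[≠] (-(N : ℂ)), 0 < (b + (N + 1 : ℕ)).re := by
  have h : ∀ᶠ b : ℂ in 𝓝 (-(N : ℂ)), 0 < (b + (N + 1 : ℕ)).re :=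
    continuousAt_const.eventually_lt (by fun_prop) (neg_natCast_add_re_pos N)
  exact h.filter_mono nhdsWithin_le_nhds

/-- With `K = N + 1` the sum contains exactly one term singular at `-N`, namely `n = N`. -/
theorem exists_polar_part_hurwitzZetaFn (hm : 2 ≤ m) (N : ℕ) :
    ∃ g : ℂ → ℂ, AnalyticAt ℂ g (-(N : ℂ)) ∧ ∀ᶠ b in 𝓝[≠] (-(N : ℂ)),
      hurwitzZetaFn m b = ((b - -(N : ℂ)) ^ m)⁻¹ + g b := by
  refine ⟨fun b => ∑ n ∈ Finset.range N, (((n : ℂ) + b) ^ m)⁻¹ + hurwitzZetaFn m (b + (N + 1 : ℕ)),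
    ?_, ?_⟩
  · refine (Finset.analyticAt_fun_sum _ fun n hn => ?_).add ?_
    · have h1 : AnalyticAt ℂ (fun b : ℂ => ((n : ℂ) + b) ^ m) (-(N : ℂ)) := by fun_prop
      exact h1.inv (pow_ne_zero _ (natCast_add_neg_ne_zero (Finset.mem_range.1 hn)))
    · exact AnalyticAt.comp_of_eq (g := fun b => hurwitzZetaFn m b)
        (f := fun b : ℂ => b + (N + 1 : ℕ))
        (analyticAt_hurwitzZetaFn_natCast hm
          (not_mem_nonposIntegers_of_re_pos (neg_natCast_add_re_pos N))) (by fun_prop) rfl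
  · filter_upwards [eventually_not_mem_nonposIntegers_punctured (-(N : ℂ)),
      eventually_re_add_natCast_pos N] with b hb hb'
    rw [hurwitzZetaFn_natCast_eq_sum_add hb hb' hm, Finset.sum_range_succ, sub_neg_eq_add,
      add_comm b (N : ℂ)]
    ring

theorem meromorphicOrderAt_hurwitzZetaFn (hm : 2 ≤ m) (N : ℕ) :
    meromorphicOrderAt (fun a => hurwitzZetaFn (m : ℂ) a) (-(N : ℂ)) = (-(m : ℤ) : ℤ) := by
  obtain ⟨g, hg, h⟩ := exists_polar_part_hurwitzZetaFn hm N
  exact meromorphicOrderAt_eq_neg_natCast (by omega) one_ne_zero hg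
    (h.mono fun b hb => by rw [hb, one_mul])

theorem hurwitzZetaFn_neg_natCast_eq_sum_add (ha : a ∉ nonposIntegers) {K : ℕ}
    (hK : 0 < (a + K).re) (m : ℕ) : hurwitzZetaFn (-(m : ℂ)) a =
      ∑ n ∈ Finset.range K, ((n : ℂ) + a) ^ m + hurwitzZetaFn (-(m : ℂ)) (a + K) := by
  have hs : -(m : ℂ) ≠ 1 := fun h => by
    have h1 := congrArg Complex.re h
    simp only [Complex.neg_re, Complex.natCast_re, Complex.one_re] at h1
    have : (0 : ℝ) ≤ m := by positivity
    linarith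
  rw [hurwitzZetaFn_eq_sum_add ha hK hs]
  simp only [neg_neg, Complex.cpow_natCast]

/-- `ζ(-m, a)` extends to an entire function. -/
theorem exists_differentiable_eq_hurwitzZetaFn_neg (m : ℕ) :
    ∃ g : ℂ → ℂ, Differentiable ℂ g ∧
      ∀ α : ℂ, α ∉ nonposIntegers → g α = hurwitzZetaFn (-(m : ℂ)) α := by
  have hs : -(m : ℂ) ≠ 1 := fun h => by
    have h1 := congrArg Complex.re h
    simp only [Complex.neg_re, Complex.natCast_re, Complex.one_re] at h1
    have : (0 : ℝ) ≤ m := by positivity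
    linarith
  -- Each `H K` is analytic on `Re a > -K`, with no exceptional points since the powers are
  -- polynomials. These functions agree on overlaps and glue to an entire function.
  let H : ℕ → ℂ → ℂ := fun K a =>
    ∑ n ∈ Finset.range K, ((n : ℂ) + a) ^ m + hurwitzZetaFn (-(m : ℂ)) (a + K)
  have hadd : ∀ (K J : ℕ) (a : ℂ), 0 < (a + K).re → H (K + J) a = H K a := by
    intro K J a hK
    have hJ : 0 < (a + K + J).re := by
      rw [Complex.add_re, Complex.natCast_re]
      positivity
    have h1 := hurwitzZetaFn_neg_natCast_eq_sum_add (not_mem_nonposIntegers_of_re_pos hK) hJ m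
    simp only [H, Finset.sum_range_add, h1]
    push_cast
    have h2 : ∀ n : ℕ, (K : ℂ) + n + a = n + (a + K) := fun n => by ring
    simp only [h2, add_assoc]
  have heq : ∀ (K J : ℕ) (a : ℂ), 0 < (a + K).re → 0 < (a + J).re → H K a = H J a := by
    intro K J a hK hJ
    rcases le_total K J with h | h
    · obtain ⟨i, rfl⟩ := Nat.exists_eq_add_of_le h
      exact (hadd K i a hK).symm
    · obtain ⟨i, rfl⟩ := Nat.exists_eq_add_of_le h
      exact hadd J i a hJ
  choose k hk using exists_re_add_natCast_pos
  refine ⟨fun a => H (k a) a, fun a => ?_, fun a ha => ?_⟩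
  · have h1 : DifferentiableAt ℂ (H (k a)) a := by
      have h2 : DifferentiableAt ℂ (fun b => hurwitzZetaFn (-(m : ℂ)) (b + k a)) a :=
        ((hasDerivAt_hurwitzZetaFn hs (hk a)).comp_add_const a (k a : ℂ)).differentiableAt
      exact DifferentiableAt.add (by fun_prop) h2
    refine h1.congr_of_eventuallyEq ?_
    have h3 : ∀ᶠ b : ℂ in 𝓝 a, 0 < (b + k a).re :=
      continuousAt_const.eventually_lt (by fun_prop) (hk a)
    filter_upwards [h3] with b hb
    exact heq _ _ b (hk b) hb
  · exact (hurwitzZetaFn_neg_natCast_eq_sum_add ha (hk a) m).symm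

end IntegerArguments

/-! ### The digamma function, its derivatives and its poles. -/

section Digamma

variable {a : ℂ}

theorem analyticAt_digamma (ha : a ∉ nonposIntegers) : AnalyticAt ℂ Complex.digamma a := by
  have h1 : AnalyticAt ℂ Complex.Gamma a := by
    refine Complex.analyticAt_iff_eventually_differentiableAt.2 ?_
    filter_upwards [eventually_not_mem_nonposIntegers ha] with b hb
    exact Complex.differentiableAt_Gamma b fun m hm => hb ⟨m, hm⟩
  exact h1.deriv.div h1 (Complex.Gamma_ne_zero fun m hm => ha ⟨m, hm⟩)

theorem digamma_eq_neg_sum_add (ha : a ∉ nonposIntegers) (K : ℕ) : Complex.digamma a =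
    -∑ n ∈ Finset.range K, 1 / ((n : ℂ) + a) + Complex.digamma (a + K) := by
  induction K with
  | zero => simp
  | succ K ih =>
    have h1 : ∀ m : ℕ, a + K ≠ -m := fun m hm =>
      natCast_add_ne_zero ha (K + m) (by push_cast; linear_combination hm)
    rw [Nat.cast_add, Nat.cast_one, ← add_assoc, Complex.digamma_apply_add_one _ h1, ih,
      Finset.sum_range_succ, add_comm (K : ℂ) a]
    ring

theorem deriv_lerchFn (ha : 0 < a.re) : deriv lerchFn a = Complex.digamma a := by
  have h := hasLogForm_hurwitzZetaFn_of_re_pos ha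
  rw [h.digamma_eq]
  have h1 : deriv lerchFn a = _ := (h.hasDerivAt_sDeriv 1).deriv
  simpa using h1

theorem hasDerivAt_digamma_of_re_pos (ha : 0 < a.re) :
    HasDerivAt Complex.digamma (hurwitzZetaFn 2 a) a := by
  refine (hasDerivAt_deriv_lerchFn ha).congr_of_eventuallyEq ?_
  filter_upwards [(isOpen_lt continuous_const Complex.continuous_re).mem_nhds ha] with b hb
  exact (deriv_lerchFn hb).symm

/-- In the right half-plane `ψ` is the derivative of `ζ'(0, ·)`, so its derivative is `ζ(2, ·)`. The
recurrences of `ψ` and of `ζ(2, ·)` carry this elsewhere. -/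
theorem hasDerivAt_digamma (ha : a ∉ nonposIntegers) :
    HasDerivAt Complex.digamma (hurwitzZetaFn 2 a) a := by
  obtain ⟨K, hK⟩ := exists_re_add_natCast_pos a
  have h1 : ∀ n ∈ Finset.range K, HasDerivAt (fun b => 1 / ((n : ℂ) + b))
      (-(((n : ℂ) + a) ^ 2)⁻¹) a := by
    intro n _
    have h2 := ((hasDerivAt_id a).const_add (n : ℂ)).fun_inv (natCast_add_ne_zero ha n)
    simp only [one_div]
    refine h2.congr_deriv ?_
    simp only [id]
    ring
  have h3 := (hasDerivAt_digamma_of_re_pos hK).comp_add_const a (K : ℂ)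
  have h4 := (HasDerivAt.fun_sum h1).fun_neg.fun_add h3
  have h5 := h4.congr_of_eventuallyEq (f₁ := Complex.digamma)
    ((eventually_not_mem_nonposIntegers ha).mono fun b hb => digamma_eq_neg_sum_add hb K)
  refine h5.congr_deriv ?_
  have h6 := hurwitzZetaFn_natCast_eq_sum_add ha hK le_rfl
  simp only [Nat.cast_ofNat] at h6
  rw [h6, Finset.sum_neg_distrib, neg_neg]

theorem iteratedDeriv_digamma (r : ℕ) : ∀ a ∉ nonposIntegers,
    iteratedDeriv (r + 1) Complex.digamma a =
      (-1) ^ r * ((r + 1).factorial : ℂ) * hurwitzZetaFn (r + 2 : ℕ) a := by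
  induction r with
  | zero =>
    intro a ha
    rw [zero_add, iteratedDeriv_one, (hasDerivAt_digamma ha).deriv]
    simp
  | succ r ih =>
    intro a ha
    rw [iteratedDeriv_succ]
    have h1 : iteratedDeriv (r + 1) Complex.digamma =ᶠ[𝓝 a] fun b =>
        (-1) ^ r * ((r + 1).factorial : ℂ) * hurwitzZetaFn (r + 2 : ℕ) b :=
      (eventually_not_mem_nonposIntegers ha).mono fun b hb => ih b hb
    rw [h1.deriv_eq, ((hasDerivAt_hurwitzZetaFn_natCast (m := r + 2) (by omega)
      ha).const_mul _).deriv, Nat.factorial_succ (r + 1)]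
    push_cast
    ring_nf

theorem exists_polar_part_digamma (N : ℕ) :
    ∃ g : ℂ → ℂ, AnalyticAt ℂ g (-(N : ℂ)) ∧ ∀ᶠ b in 𝓝[≠] (-(N : ℂ)),
      Complex.digamma b = -1 * ((b - -(N : ℂ)) ^ 1)⁻¹ + g b := by
  refine ⟨fun b => -∑ n ∈ Finset.range N, 1 / ((n : ℂ) + b) + Complex.digamma (b + (N + 1 : ℕ)),
    ?_, ?_⟩
  · refine (Finset.analyticAt_fun_sum _ fun n hn => ?_).neg.add ?_
    · exact analyticAt_const.div (by fun_prop) (natCast_add_neg_ne_zero (Finset.mem_range.1 hn))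
    · exact AnalyticAt.comp_of_eq (g := Complex.digamma) (f := fun b : ℂ => b + (N + 1 : ℕ))
        (analyticAt_digamma (not_mem_nonposIntegers_of_re_pos (neg_natCast_add_re_pos N)))
        (by fun_prop) rfl
  · filter_upwards [eventually_not_mem_nonposIntegers_punctured (-(N : ℂ))] with b hb
    rw [digamma_eq_neg_sum_add hb (N + 1), Finset.sum_range_succ, sub_neg_eq_add,
      add_comm b (N : ℂ), pow_one, one_div ((N : ℂ) + b)]
    ring

theorem meromorphicOrderAt_digamma (N : ℕ) :
    meromorphicOrderAt Complex.digamma (-(N : ℂ)) = (-1 : ℤ) := by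
  obtain ⟨g, hg, h⟩ := exists_polar_part_digamma N
  exact meromorphicOrderAt_eq_neg_natCast one_ne_zero (by norm_num) hg h

theorem meromorphicOrderAt_laurentGamma_zero (N : ℕ) :
    meromorphicOrderAt (fun α => laurentGamma hurwitzZetaFn 0 α) (-(N : ℂ)) = (-1 : ℤ) := by
  obtain ⟨g, hg, h⟩ := exists_polar_part_digamma N
  refine meromorphicOrderAt_eq_neg_natCast one_ne_zero (c := 1) one_ne_zero hg.neg ?_
  filter_upwards [h, eventually_not_mem_nonposIntegers_punctured (-(N : ℂ))] with b hb hb'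
  rw [digamma_eq_neg_laurentGamma hb'] at hb
  rw [Pi.neg_apply]
  linear_combination -hb

theorem meromorphicOrderAt_iteratedDeriv_digamma (r N : ℕ) :
    meromorphicOrderAt (iteratedDeriv (r + 1) Complex.digamma) (-(N : ℂ)) =
      (-((r + 2 : ℕ) : ℤ) : ℤ) := by
  obtain ⟨g, hg, h⟩ := exists_polar_part_hurwitzZetaFn (m := r + 2) (by omega) N
  have hc : (-1 : ℂ) ^ r * ((r + 1).factorial : ℂ) ≠ 0 :=
    mul_ne_zero (pow_ne_zero _ (by norm_num)) (by exact_mod_cast (r + 1).factorial_ne_zero)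
  refine meromorphicOrderAt_eq_neg_natCast (by omega) hc
    (analyticAt_const.mul hg (f := fun _ => (-1 : ℂ) ^ r * ((r + 1).factorial : ℂ))) ?_
  filter_upwards [h, eventually_not_mem_nonposIntegers_punctured (-(N : ℂ))] with b hb hb'
  rw [iteratedDeriv_digamma r b hb', hb]
  simp only [Pi.mul_apply]
  ring

end Digamma

/-! ### Splitting off the first `k` terms in the disc `|α| < k`. -/

section Decomposition

theorem re_add_natCast_pos_of_mem_ball {k : ℕ} {a : ℂ} (ha : a ∈ Metric.ball (0 : ℂ) k) :
    0 < (a + k).re := by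
  rw [mem_ball_zero_iff] at ha
  have := (abs_le.1 (Complex.abs_re_le_norm a)).1
  simp only [Complex.add_re, Complex.natCast_re]
  linarith

theorem sDeriv_hurwitzZetaFn_eq_sum_add {k : ℕ} {s a : ℂ} (hs : s ≠ 1) (ha : a ∉ nonposIntegers)
    (hk : 0 < (a + k).re) (r : ℕ) : sDeriv hurwitzZetaFn r s a =
      ∑ n ∈ Finset.range k, ((n : ℂ) + a) ^ (-s) * (-Complex.log ((n : ℂ) + a)) ^ r
        + sDeriv hurwitzZetaFn r s (a + k) := by
  have hpow : ∀ (n : ℕ) (w : ℂ),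
      ((n : ℂ) + a) ^ (-w) = Complex.exp (-(w * Complex.log ((n : ℂ) + a))) := fun n w => by
    rw [Complex.cpow_def_of_ne_zero (natCast_add_ne_zero ha n)]
    ring_nf
  have h1 : (fun w => hurwitzZetaFn w a) =ᶠ[𝓝 s]
      fun w => logSum k (fun n b => Complex.log (n + b)) w a := by
    filter_upwards [isOpen_compl_singleton.mem_nhds hs] with w hw
    rw [hurwitzZetaFn_eq_sum_add ha hk hw, logSum]
    simp only [hpow]
  have h2 : sDeriv hurwitzZetaFn r s a =
      sDeriv (logSum k (fun n b => Complex.log (n + b))) r s a := h1.iteratedDeriv_eq r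
  rw [h2, sDeriv_logSum hs hk]
  simp only [hpow]

end Decomposition

/-! ### The main theorem. -/

theorem mainTheorem2 :
    -- `ζ(s, α)` is the analytic continuation of its series, with a simple pole at `s = 1`
    (∀ α : ℂ, α ∉ nonposIntegers →
      IsHurwitzContinuation α (fun s => hurwitzZetaFn s α) ∧
      Tendsto (fun s => (s - 1) * hurwitzZetaFn s α) (𝓝[≠] 1) (𝓝 1)) ∧
    -- the Laurent expansion `ζ(s + 1, α) = 1/s + ∑ γ_n(α) s^n`, with `γ_{-1} = 1`
    (∀ α : ℂ, α ∉ nonposIntegers → laurentGamma hurwitzZetaFn (-1) α = 1 ∧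
      ∀ s : ℂ, s ≠ 0 →
        HasSum (fun n : ℕ => laurentGamma hurwitzZetaFn n α * s ^ n)
          (hurwitzZetaFn (s + 1) α - 1 / s)) ∧
    -- analyticity in `α`: the principal determination on the slit plane ...
    (∀ α₀ ∈ Complex.slitPlane, IsHurwitzBranchAt hurwitzZetaFn α₀) ∧
    (∀ (r : ℕ) (s : ℂ), s ≠ 1 → ∀ α₀ ∈ Complex.slitPlane,
      AnalyticAt ℂ (fun α => sDeriv hurwitzZetaFn r s α) α₀) ∧
    -- ... continuation along every path that avoids `0, -1, -2, …` ...
    (∀ (α₀ : ℂ) (p : Path (1 : ℂ) α₀), (∀ t, p t ∉ nonposIntegers) →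
      ∃ F : unitInterval → ℂ → ℂ → ℂ, IsContinuationAlong p F) ∧
    (∀ (Z : ℂ → ℂ → ℂ) (α₀ : ℂ), IsHurwitzBranchAt Z α₀ →
      ∀ (r : ℕ) (s : ℂ), s ≠ 1 → AnalyticAt ℂ (fun α => sDeriv Z r s α) α₀) ∧
    -- ... and the decomposition in the disc `|α| < k`, also for `ψ`
    (∀ k : ℕ, 1 ≤ k → ∃ φ : ℂ → ℂ → ℂ,
      (∀ s : ℂ, s ≠ 1 → ∀ α ∈ Metric.ball (0 : ℂ) k,
        AnalyticAt ℂ (fun z : ℂ × ℂ => φ z.1 z.2) (s, α)) ∧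
      (∀ (r : ℕ) (s : ℂ), s ≠ 1 → ∀ α ∈ Metric.ball (0 : ℂ) k, α ∉ nonposIntegers →
        sDeriv hurwitzZetaFn r s α =
          ∑ n ∈ Finset.range k, ((n : ℂ) + α) ^ (-s) * (-Complex.log ((n : ℂ) + α)) ^ r
            + sDeriv φ r s α) ∧
      (∀ α ∈ Metric.ball (0 : ℂ) k, α ∉ nonposIntegers →
        Complex.digamma α =
          -∑ n ∈ Finset.range k, 1 / ((n : ℂ) + α) + deriv (fun a => sDeriv φ 1 0 a) α)) ∧
    -- 1) `ζ(-m, α)` is entire in `α` for integers `m ≥ 0`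
    (∀ m : ℕ, ∃ g : ℂ → ℂ, Differentiable ℂ g ∧
      ∀ α : ℂ, α ∉ nonposIntegers → g α = hurwitzZetaFn (-(m : ℂ)) α) ∧
    -- 2) for integers `m ≥ 2`, `ζ(m, α)` has a pole of order `m` at each non-positive integer
    -- and no other singularities
    (∀ m : ℕ, 2 ≤ m →
      (∀ α ∉ nonposIntegers, AnalyticAt ℂ (fun a => hurwitzZetaFn (m : ℂ) a) α) ∧
      ∀ n : ℕ, meromorphicOrderAt (fun a => hurwitzZetaFn (m : ℂ) a) (-(n : ℂ)) = (-(m : ℤ) : ℤ)) ∧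
    -- 3) for `Re s < 0` all branches extend continuously, also to `0, -1, -2, …`
    (∀ (Z : ℂ → ℂ → ℂ) (U : Set ℂ), IsOpen U → Convex ℝ U →
      (∀ α₀ ∈ U, IsHurwitzBranchAt Z α₀) →
      ∀ (r : ℕ) (s : ℂ), s.re < 0 → ∃ g : ℂ → ℂ,
        ContinuousOn g (closure U) ∧ ∀ α ∈ U, g α = sDeriv Z r s α) ∧
    -- 4) for every branch: mixed derivatives commute, `∂/∂α ζ^{(r)}(0, α) = -r! γ_{r-1}(α)`,
    -- `exp ζ'(0, α) = Γ(α) / √(2π)`, `∂/∂α ζ'(0, α) = -γ_0(α) = ψ(α)`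
    (∀ (Z : ℂ → ℂ → ℂ) (α₀ : ℂ), IsHurwitzBranchAt Z α₀ →
      (∀ (r₁ r₂ : ℕ) (s : ℂ), s ≠ 1 →
        iteratedDeriv r₁ (fun α => iteratedDeriv r₂ (fun w => Z w α) s) α₀ =
          iteratedDeriv r₂ (fun w => iteratedDeriv r₁ (fun α => Z w α) α₀) s) ∧
      (∀ r : ℕ,
        HasDerivAt (fun α => sDeriv Z r 0 α)
          (-(r.factorial : ℂ) * laurentGamma Z ((r : ℤ) - 1) α₀) α₀ ∧
        iteratedDeriv r (fun w => deriv (fun α => Z w α) α₀) 0 =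
          -(r.factorial : ℂ) * laurentGamma Z ((r : ℤ) - 1) α₀) ∧
      Complex.exp (sDeriv Z 1 0 α₀) = Complex.Gamma α₀ / (Real.sqrt (2 * Real.pi) : ℂ) ∧
      laurentGamma Z (-1) α₀ = 1 ∧
      (∀ s : ℂ, s ≠ 0 →
        HasSum (fun n : ℕ => laurentGamma Z n α₀ * s ^ n) (Z (s + 1) α₀ - 1 / s)) ∧
      Complex.digamma α₀ = -laurentGamma Z 0 α₀) ∧
    (∀ α : ℂ, α ∉ nonposIntegers → Complex.digamma α = -laurentGamma hurwitzZetaFn 0 α) ∧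
    Complex.digamma 1 = -(Real.eulerMascheroniConstant : ℂ) ∧
    -- 5) `ψ = -γ_0` has simple poles at the non-positive integers, its `r`-th derivative is
    -- `(-1)^(r-1) r! ζ(r + 1, α)` and has poles of order `r + 1` there; no other singularities
    (∀ α ∉ nonposIntegers, AnalyticAt ℂ Complex.digamma α) ∧
    (∀ n : ℕ, meromorphicOrderAt Complex.digamma (-(n : ℂ)) = (-1 : ℤ) ∧
      meromorphicOrderAt (fun α => laurentGamma hurwitzZetaFn 0 α) (-(n : ℂ)) = (-1 : ℤ)) ∧
    (∀ r : ℕ, 1 ≤ r →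
      (∀ α ∉ nonposIntegers,
        iteratedDeriv r Complex.digamma α =
            (-1) ^ (r - 1) * (r.factorial : ℂ) * hurwitzZetaFn ((r : ℂ) + 1) α ∧
          AnalyticAt ℂ (iteratedDeriv r Complex.digamma) α) ∧
      ∀ n : ℕ, meromorphicOrderAt (iteratedDeriv r Complex.digamma) (-(n : ℂ)) =
        (-((r : ℤ) + 1) : ℤ)) := by
  refine ⟨fun α hα => ⟨isHurwitzContinuation_hurwitzZetaFn hα, tendsto_sub_one_mul_hurwitzZetaFn hα⟩,
    fun α hα => ⟨laurentGamma_neg_one _ _, fun s hs => hasSum_laurentGamma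
      (isHurwitzContinuation_hurwitzZetaFn hα).1 (tendsto_sub_one_mul_hurwitzZetaFn hα) hs⟩,
    fun α₀ hα => isHurwitzBranchAt_hurwitzZetaFn hα,
    fun r s hs α₀ hα => analyticAt_sDeriv_snd (analyticAt_hurwitzZetaFn hs hα) r,
    fun α₀ p hp => ?_, fun Z α₀ hZ r s hs => ?_, fun k _ => ?_,
    exists_differentiable_eq_hurwitzZetaFn_neg,
    fun m hm => ⟨fun α hα => analyticAt_hurwitzZetaFn_natCast hm hα,
      meromorphicOrderAt_hurwitzZetaFn hm⟩,
    fun Z U hU hc hZ r s hs => ?_, fun Z α₀ hZ => ?_,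
    fun α hα => digamma_eq_neg_laurentGamma hα, Complex.digamma_one,
    fun α hα => analyticAt_digamma hα,
    fun n => ⟨meromorphicOrderAt_digamma n, meromorphicOrderAt_laurentGamma_zero n⟩,
    fun r hr => ?_⟩
  · obtain ⟨K, hK⟩ := exists_isContinuationAlong hp
    obtain ⟨ℓ, -, hℓ⟩ := hK K le_rfl
    exact ⟨_, hℓ⟩
  · obtain ⟨K, hK⟩ := hZ.exists_hasLogForm
    obtain ⟨ℓ, hℓ⟩ := hK K le_rfl
    exact analyticAt_sDeriv_snd (hℓ.analyticAt hs) r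
  -- The regular part is `φ_k(s, α) = ζ(s, α + k)`, since `|α| < k` puts `α + k` into the right
  -- half-plane.
  · refine ⟨fun s α => hurwitzZetaFn s (α + k),
      fun s hs α hα => analyticAt_hurwitzZetaFn_add (re_add_natCast_pos_of_mem_ball hα) hs,
      fun r s hs α hα hN =>
        sDeriv_hurwitzZetaFn_eq_sum_add hs hN (re_add_natCast_pos_of_mem_ball hα) r,
      fun α hα hN => ?_⟩
    rw [digamma_eq_neg_sum_add hN k, ← deriv_lerchFn (re_add_natCast_pos_of_mem_ball hα)]
    congr 1
    exact (deriv_comp_add_const lerchFn (k : ℂ) α).symm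
  · have hlim : ∀ β ∈ closure U, ∃ y, Tendsto (fun b => sDeriv Z r s b) (𝓝[U] β) (𝓝 y) :=
      fun β hβ => IsHurwitzBranchAt.exists_tendsto_sDeriv hU hc hZ r hs hβ
    have hs1 : s ≠ 1 := by rintro rfl; simp at hs; linarith
    -- Existence of the limit at each point of the closure already makes the extension continuous,
    -- the target being regular.
    refine ⟨extendFrom U fun b => sDeriv Z r s b, continuousOn_extendFrom subset_rfl hlim,
      fun α hα => extendFrom_eq (subset_closure hα) ?_⟩
    obtain ⟨K, hK⟩ := (hZ α hα).exists_hasLogForm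
    obtain ⟨ℓ, hℓ⟩ := hK K le_rfl
    exact (analyticAt_sDeriv_snd (hℓ.analyticAt hs1) r).continuousAt.tendsto.mono_left
      nhdsWithin_le_nhds
  · obtain ⟨K, hK⟩ := hZ.exists_hasLogForm
    obtain ⟨ℓ, hℓ⟩ := hK K le_rfl
    exact ⟨fun r₁ r₂ s hs => iteratedDeriv_comm (hℓ.analyticAt hs) r₁ r₂,
      fun r => ⟨hℓ.hasDerivAt_sDeriv r, hℓ.iteratedDeriv_deriv r⟩, hℓ.exp_sDeriv,
      laurentGamma_neg_one _ _,
      fun s hs => hasSum_laurentGamma hℓ.differentiableOn hℓ.tendsto_sub_one_mul hs, hℓ.digamma_eq⟩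
  · obtain ⟨q, rfl⟩ := Nat.exists_eq_add_of_le' hr
    have hval : ∀ α ∉ nonposIntegers, iteratedDeriv (q + 1) Complex.digamma α =
        (-1) ^ q * ((q + 1).factorial : ℂ) * hurwitzZetaFn (q + 2 : ℕ) α := iteratedDeriv_digamma q
    refine ⟨fun α hα => ⟨?_, ?_⟩, fun n => ?_⟩
    · rw [hval α hα, Nat.add_sub_cancel]
      push_cast
      ring_nf
    · refine (analyticAt_const.mul (analyticAt_hurwitzZetaFn_natCast (m := q + 2) (by omega)
        hα)).congr ((eventually_not_mem_nonposIntegers hα).mono fun b hb => (hval b hb).symm)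
    · have hq : ((q + 2 : ℕ) : ℤ) = ((q + 1 : ℕ) : ℤ) + 1 := by
        push_cast
        ring
      rw [meromorphicOrderAt_iteratedDeriv_digamma, hq]
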